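/- For integers $k\ge 0$ and $n\ge 1$ let $d_k(n)=\#\{(n_1,\dots,n_k)\in\mathbb{Z}_{\ge1}^k : n_1\cdots n_k=n\}$ be the $k$-fold divisor function (so $d_0(1)=1$ and $d_0(n)=0$ for $n\ge 2$). For every fixed integer $k\ge 0$, $$\int_0^T\Bigl|\sum_{1\le n<T}\frac{d_k(n)}{n^{\frac12+it}}\Bigr|^2\,dt\;\sim\;\frac{a_k}{(k^2)!}\,T\log^{k^2}T\qquad (T\to\infty,\ T \text{ real}),$$ where $$a_k=\prod_p\Bigl(1-\frac1p\Bigr)^{k^2}\sum_{m=0}^\infty\binom{k+m-1}{m}^2p^{-m}$$ (with $\binom{-1}{0}=1$ and $\binom{m-1}{m}=0$ for $m\ge1$), the product being over all primes $p$. Here the series over $m$ and the product over $p$ (in any order of the primes) converge, and $\binom{k+m-1}{m}=d_k(p^m)$ for every prime $p$ and every $m\ge0$. Moreover, the Dirichlet series $F(s)=\sum_{n\ge1}d_k(n)^2n^{-s}$ converges absolutely for $\operatorname{Re}s>1$, and $$a_k=\lim_{s\to1}(s-1)^{k^2}F(s)=\lim_{s\to1}\zeta(s)^{-k^2}F(s),$$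 where $s\to1$ through complex numbers with $\operatorname{Re}s>1$. -/

import Mathlib

open Filter Topology Asymptotics
open scoped Nat

noncomputable section

/-- The `k`-fold divisor function: the number of `k`-tuples `(n₁, …, n_k)` of natural numbers
with `n₁ ⋯ n_k = n` (for `n ≥ 1`; the value at `n = 0` is `0` and is never used). -/
def divisorK (k n : ℕ) : ℕ := (Nat.finMulAntidiag k n).card

/-- The Dirichlet polynomial `∑_{1 ≤ n < T} d_k(n) / n^{1/2 + it}`. For natural numbers `n`,
`n < ⌈T⌉₊` is equivalent to `n < T`. -/
def divisorPoly (k : ℕ) (T t : ℝ) : ℂ :=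
  ∑ n ∈ Finset.Ico 1 ⌈T⌉₊, (divisorK k n : ℂ) / (n : ℂ) ^ (1 / 2 + (t : ℂ) * Complex.I)

/-- The `m`-th term `binom(k+m-1, m)² p^{-m}` of the local series at `p`. The truncated
subtraction is harmless: at `k = m = 0` the binomial coefficient is `1`, as is usual for
`binom(-1, 0)`. -/
def localTerm (k p m : ℕ) : ℝ :=
  ((k + m - 1).choose m : ℝ) ^ 2 * ((p : ℝ) ^ m)⁻¹

/-- The Euler factor `(1 - 1/p)^{k²} ∑_{m ≥ 0} binom(k+m-1, m)² p^{-m}`. -/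
def localFactor (k p : ℕ) : ℝ :=
  (1 - 1 / (p : ℝ)) ^ (k ^ 2) * ∑' m : ℕ, localTerm k p m

/-- The arithmetic factor `a_k`, the product of the Euler factors over all primes. -/
def arithFactor (k : ℕ) : ℝ := ∏' p : Nat.Primes, localFactor k p

/-- The Dirichlet series `F(s) = ∑_{n ≥ 1} d_k(n)² / n^s`. -/
def divisorSqSeries (k : ℕ) (s : ℂ) : ℂ :=
  LSeries (fun n => (divisorK k n : ℂ) ^ 2) s

end

/-!
The Dirichlet polynomial is split at `T / log² T`, and its mean square is compared with
`T ∑ d_k(n)²/n`.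

*Arithmetic.* Write `d_k² = g * d_{k²}` as a Dirichlet convolution (`divisorSqQuot` is `g`). Then
`g` is multiplicative, and its Bell series at every prime is the fixed power series
`(1 - X)^{k²} ∑ binom(k+m-1, m)² X^m = 1 + O(X²)`; the linear term vanishes because
`d_k(p)² = k² = d_{k²}(p)` (`coeff_one_quotSeries`). Hence the Euler factors of `∑ g(n)/n` are
`1 + O(p⁻²)`, the series converges absolutely (`summable_divisorSqQuot_div`), its sum is `a_k`
(`arithFactor_eq_tsum`), and `a_k ≠ 0` (`arithFactor_ne_zero`). For `Re s > 1` this gives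
`F(s) = ζ(s)^{k²} G(s)` (`divisorSqSeries_eq`), where `G(s) = ∑ g(n) n^{-s}` is continuous on
`Re s ≥ 1` and `G(1) = a_k`; with the residue of `ζ`, both limits at `s = 1` follow.

*Logarithmic means.* A telescoping induction gives
`log^n x ≤ n! ∑_{m ≤ x} d_n(m)/m ≤ (log x + n)^n` (`logSum_zeta_pow_bounds`). Convolving with `g`,
by dominated convergence, `∑_{n ≤ x} d_k(n)²/n ∼ a_k/(k²)! log^{k²} x`
(`tendsto_logSum_divisorSq_div`).

*Mean values.* For a Dirichlet polynomial of length `X` with coefficients `c_n`, bounding the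
off-diagonal terms of the mean square over `[0, T]` trivially gives
`(T + O(X log X)) ∑ c_n²` (`abs_integral_polySq_sub_le`). This suffices for the terms with
`n ≤ T / log² T`, but the logarithm is too expensive for the remaining ones. For those an upper
bound `O(T ∑ c_n²)` is enough, and it holds for every polynomial of length `T`: a triangular weight
has a Fourier transform that decays quadratically (`integral_polySq_le`). As `log (T / log² T) ∼ log T`,
the sum of `d_k(n)²/n` over `T / log² T < n < T` is `o(log^{k²} T)`, so these terms
are negligible. In this way only the logarithmic mean of `d_k²` is needed, and neither a Hilbert
inequality with weights nor a bound for `∑_{n ≤ x} d_k(n)²`.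
-/

section

open ArithmeticFunction ArithmeticFunction.zeta ArithmeticFunction.Moebius

/-! ### The divisor function and its local factors -/

theorem divisorK_eq_zeta_pow (k n : ℕ) : divisorK k n = (ζ ^ k) n := by
  induction k generalizing n with
  | zero =>
    rw [pow_zero, one_apply, divisorK]
    split_ifs with h
    · simp [h, Nat.finMulAntidiag_one]
    · simp [Nat.finMulAntidiag_zero_left h]
  | succ k ih =>
    rw [pow_succ', mul_apply, divisorK]
    have key : Nat.finMulAntidiag (k + 1) n = n.divisorsAntidiagonal.biUnion
        (fun p => (Nat.finMulAntidiag k p.2).map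
          ⟨Fin.cons p.1, Fin.cons_right_injective (α := fun _ => ℕ) p.1⟩) := by
      ext f
      simp only [Nat.mem_finMulAntidiag, Finset.mem_biUnion, Nat.mem_divisorsAntidiagonal,
        Finset.mem_map, Function.Embedding.coeFn_mk, Prod.exists]
      constructor
      · rintro ⟨h, hn⟩
        rw [Fin.prod_univ_succ] at h
        refine ⟨f 0, ∏ i : Fin k, f i.succ, ⟨h, hn⟩, Fin.tail f, ⟨rfl, ?_⟩, Fin.cons_self_tail f⟩
        rintro h0
        simp [h0] at h
        exact hn h.symm
      · rintro ⟨a, b, ⟨h, hn⟩, f', ⟨h', hb⟩, rfl⟩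
        refine ⟨?_, hn⟩
        rw [Fin.prod_univ_succ]
        simp [h', h]
    -- a `(k+1)`-tuple is its first entry followed by a `k`-tuple
    rw [key, Finset.card_biUnion]
    · refine Finset.sum_congr rfl fun p hp => ?_
      have := Nat.ne_zero_of_mem_divisorsAntidiagonal hp
      rw [Finset.card_map, ← ih, zeta_apply_ne this.1, one_mul, divisorK]
    · intro p hp q hq hpq
      rw [Function.onFun, Finset.disjoint_left]
      intro f hf hf'
      simp only [Finset.mem_map, Function.Embedding.coeFn_mk, Nat.mem_finMulAntidiag] at hf hf'
      obtain ⟨u, ⟨hu, -⟩, rfl⟩ := hf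
      obtain ⟨v, ⟨hv, -⟩, huv⟩ := hf'
      rw [Fin.cons_inj] at huv
      obtain ⟨h1, rfl⟩ := huv
      exact hpq (Prod.ext h1.symm (hu.symm.trans hv))

/-- The Bell series `∑ f(p^e) X^e` of an arithmetic function at `p`. -/
noncomputable def bellSeries {R : Type*} [Semiring R] (p : ℕ) (f : ArithmeticFunction R) :
    PowerSeries R :=
  PowerSeries.mk fun e => f (p ^ e)

theorem bellSeries_mul {R : Type*} [Semiring R] {p : ℕ} (hp : p.Prime)
    (f g : ArithmeticFunction R) : bellSeries p (f * g) = bellSeries p f * bellSeries p g := by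
  ext e
  simp only [bellSeries, PowerSeries.coeff_mk, PowerSeries.coeff_mul, ArithmeticFunction.mul_apply]
  rw [Nat.sum_divisorsAntidiagonal (fun a b => f a * g b), Nat.divisors_prime_pow hp,
    Finset.sum_map,
    Finset.Nat.sum_antidiagonal_eq_sum_range_succ (fun a b => f (p ^ a) * g (p ^ b))]
  refine Finset.sum_congr rfl fun i hi => ?_
  rw [Function.Embedding.coeFn_mk, Nat.pow_div (by simp at hi; omega) hp.pos]

theorem bellSeries_pow {R : Type*} [Semiring R] {p : ℕ} (hp : p.Prime)
    (f : ArithmeticFunction R) (k : ℕ) : bellSeries p (f ^ k) = bellSeries p f ^ k := by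
  induction k with
  | zero =>
    ext e
    simp [bellSeries, ArithmeticFunction.one_apply, PowerSeries.coeff_one, hp.ne_one]
  | succ k ih => rw [pow_succ, pow_succ, bellSeries_mul hp, ih]

theorem zeta_pow_prime_pow (k : ℕ) {p : ℕ} (hp : p.Prime) (m : ℕ) :
    (ζ ^ k) (p ^ m) = Nat.multichoose k m := by
  induction k generalizing m with
  | zero =>
    cases m with
    | zero => simp
    | succ m => simp [one_apply, hp.ne_one]
  | succ k ih =>
    have h : (ζ ^ (k + 1)) (p ^ m) = ∑ i ∈ Finset.range (m + 1), Nat.multichoose k i := by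
      rw [pow_succ, mul_zeta_apply, Nat.divisors_prime_pow hp, Finset.sum_map]
      exact Finset.sum_congr rfl fun i _ => ih i
    rw [h]
    clear h ih
    induction m with
    | zero => simp
    | succ m ih => rw [Finset.sum_range_succ, ih, Nat.multichoose_succ_succ, add_comm]

theorem divisorK_prime_pow (k : ℕ) {p : ℕ} (hp : p.Prime) (m : ℕ) :
    divisorK k (p ^ m) = (k + m - 1).choose m := by
  rw [divisorK_eq_zeta_pow, zeta_pow_prime_pow k hp, Nat.multichoose_eq]

/-- The arithmetic function `d_k²`, with integer values so that it can be divided by `d_{k²}` and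
cast to both `ℝ` and `ℂ`. -/
noncomputable def divisorSq (k : ℕ) : ArithmeticFunction ℤ :=
  pmul ((ζ ^ k : ArithmeticFunction ℕ) : ArithmeticFunction ℤ)
    ((ζ ^ k : ArithmeticFunction ℕ) : ArithmeticFunction ℤ)

theorem divisorSq_apply (k n : ℕ) : divisorSq k n = (divisorK k n : ℤ) ^ 2 := by
  rw [divisorSq, pmul_apply, natCoe_apply, divisorK_eq_zeta_pow, sq]

/-- The arithmetic function `g` with `d_k² = g * d_{k²}` (Dirichlet convolution); it is
`d_k² * μ * ⋯ * μ` with `k²` factors `μ`. -/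
noncomputable def divisorSqQuot (k : ℕ) : ArithmeticFunction ℤ := divisorSq k * μ ^ (k ^ 2)

theorem divisorSqQuot_mul_zeta_pow (k : ℕ) :
    divisorSqQuot k * ((ζ : ArithmeticFunction ℤ) ^ (k ^ 2)) = divisorSq k := by
  rw [divisorSqQuot, mul_assoc, ← mul_pow, moebius_mul_coe_zeta, one_pow, mul_one]

theorem isMultiplicative_divisorSqQuot (k : ℕ) : (divisorSqQuot k).IsMultiplicative := by
  have h : ((ζ ^ k : ArithmeticFunction ℕ) : ArithmeticFunction ℤ).IsMultiplicative :=
    (isMultiplicative_zeta.pow).natCast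
  exact (h.pmul h).mul (isMultiplicative_moebius.pow)

/-- The power series `∑ binom(k+m-1, m)² X^m`. -/
noncomputable def binomSqSeries (k : ℕ) : PowerSeries ℤ :=
  PowerSeries.mk fun m => (Nat.multichoose k m : ℤ) ^ 2

/-- The power series `(1 - X)^{k²} ∑ binom(k+m-1, m)² X^m`, which is the Bell series of
`divisorSqQuot k` at every prime. -/
noncomputable def quotSeries (k : ℕ) : PowerSeries ℤ :=
  (1 - PowerSeries.X) ^ (k ^ 2) * binomSqSeries k

theorem bellSeries_moebius {p : ℕ} (hp : p.Prime) : bellSeries p μ = 1 - PowerSeries.X := by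
  have h1 : bellSeries p (ζ : ArithmeticFunction ℤ) = PowerSeries.mk 1 := by
    ext e
    simp [bellSeries, hp.ne_zero]
  have h2 : bellSeries p μ * PowerSeries.mk 1 = 1 := by
    rw [← h1, ← bellSeries_mul hp, moebius_mul_coe_zeta, ← pow_zero μ, bellSeries_pow hp, pow_zero]
  calc bellSeries p μ
      = bellSeries p μ * (PowerSeries.mk 1 * (1 - PowerSeries.X)) := by
        rw [PowerSeries.mk_one_mul_one_sub_eq_one, mul_one]
    _ = _ := by rw [← mul_assoc, h2, one_mul]

theorem divisorSqQuot_prime_pow (k : ℕ) {p : ℕ} (hp : p.Prime) (e : ℕ) :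
    divisorSqQuot k (p ^ e) = PowerSeries.coeff e (quotSeries k) := by
  have h : bellSeries p (divisorSq k) = binomSqSeries k := by
    ext m
    simp only [bellSeries, binomSqSeries, PowerSeries.coeff_mk, divisorSq_apply,
      divisorK_eq_zeta_pow, zeta_pow_prime_pow k hp]
  rw [quotSeries, mul_comm, ← h, ← bellSeries_moebius hp, ← bellSeries_pow hp, ← bellSeries_mul hp,
    bellSeries, PowerSeries.coeff_mk, divisorSqQuot]

theorem coeff_zero_quotSeries (k : ℕ) : PowerSeries.coeff 0 (quotSeries k) = 1 := by
  simp [quotSeries, binomSqSeries]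

/-- The linear term vanishes because `d_k(p)² = k²`. -/
theorem coeff_one_quotSeries (k : ℕ) : PowerSeries.coeff 1 (quotSeries k) = 0 := by
  have h : ∀ n : ℕ, PowerSeries.coeff 1 ((1 - PowerSeries.X : PowerSeries ℤ) ^ n) = -n := by
    intro n
    induction n with
    | zero => simp [PowerSeries.coeff_one]
    | succ n ih =>
      rw [pow_succ, PowerSeries.coeff_mul, Finset.Nat.antidiagonal_succ]
      simp [ih, PowerSeries.coeff_one]
  rw [quotSeries, PowerSeries.coeff_mul, Finset.Nat.antidiagonal_succ]
  simp [h, binomSqSeries]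

/-! ### Values of power series -/

/-- Absolute convergence of a power series with integer coefficients at the real number `r`. -/
def AbsSummableAt (A : PowerSeries ℤ) (r : ℝ) : Prop :=
  Summable fun e : ℕ => ‖((PowerSeries.coeff e A : ℤ) : ℝ) * r ^ e‖

/-- The value of a power series with integer coefficients at the real number `r`. -/
noncomputable def seriesValue (A : PowerSeries ℤ) (r : ℝ) : ℝ :=
  ∑' e : ℕ, ((PowerSeries.coeff e A : ℤ) : ℝ) * r ^ e

theorem coeff_mul_mul_pow (A B : PowerSeries ℤ) (r : ℝ) (e : ℕ) :
    ((PowerSeries.coeff e (A * B) : ℤ) : ℝ) * r ^ e =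
      ∑ x ∈ Finset.HasAntidiagonal.antidiagonal e,
      (((PowerSeries.coeff x.1 A : ℤ) : ℝ) * r ^ x.1) *
        (((PowerSeries.coeff x.2 B : ℤ) : ℝ) * r ^ x.2) := by
  rw [PowerSeries.coeff_mul]
  push_cast
  rw [Finset.sum_mul]
  refine Finset.sum_congr rfl fun x hx => ?_
  rw [← Finset.HasAntidiagonal.mem_antidiagonal.mp hx]
  ring

theorem AbsSummableAt.mul {A B : PowerSeries ℤ} {r : ℝ} (hA : AbsSummableAt A r)
    (hB : AbsSummableAt B r) : AbsSummableAt (A * B) r := by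
  have := summable_norm_sum_mul_antidiagonal_of_summable_norm hA hB
  unfold AbsSummableAt
  simpa only [coeff_mul_mul_pow] using this

theorem seriesValue_mul {A B : PowerSeries ℤ} {r : ℝ} (hA : AbsSummableAt A r)
    (hB : AbsSummableAt B r) : seriesValue (A * B) r = seriesValue A r * seriesValue B r := by
  simp only [seriesValue, coeff_mul_mul_pow]
  exact (tsum_mul_tsum_eq_tsum_sum_antidiagonal_of_summable_norm hA hB).symm

/-- The polynomial `(1 - X)^n` converges everywhere, with the expected value. -/
theorem one_sub_X_pow_value (r : ℝ) (n : ℕ) :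
    AbsSummableAt ((1 - PowerSeries.X) ^ n) r ∧
      seriesValue ((1 - PowerSeries.X) ^ n) r = (1 - r) ^ n := by
  have h0 : ∀ e ∉ Finset.range 1,
      ((PowerSeries.coeff e (1 : PowerSeries ℤ) : ℤ) : ℝ) * r ^ e = 0 := by
    intro e he
    have : e ≠ 0 := by simpa using he
    simp [PowerSeries.coeff_one, this]
  have h1 : ∀ e ∉ Finset.range 2,
      ((PowerSeries.coeff e (1 - PowerSeries.X : PowerSeries ℤ) : ℤ) : ℝ) * r ^ e = 0 := by
    intro e he
    have h2 : 1 < e := by simpa using he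
    have h3 : e ≠ 0 := by omega
    have h4 : e ≠ 1 := by omega
    simp [PowerSeries.coeff_one, PowerSeries.coeff_X, h3, h4]
  have s1 : AbsSummableAt (1 - PowerSeries.X) r :=
    summable_of_ne_finset_zero (s := Finset.range 2) fun e he => by rw [h1 e he, norm_zero]
  induction n with
  | zero =>
    rw [pow_zero, pow_zero]
    refine ⟨summable_of_ne_finset_zero (s := Finset.range 1)
      fun e he => by rw [h0 e he, norm_zero], ?_⟩
    rw [seriesValue, tsum_eq_sum h0]
    simp
  | succ n ih =>
    rw [pow_succ, pow_succ]
    refine ⟨ih.1.mul s1, ?_⟩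
    rw [seriesValue_mul ih.1 s1, ih.2]
    congr 1
    rw [seriesValue, tsum_eq_sum h1]
    simp [Finset.sum_range_succ, PowerSeries.coeff_one, PowerSeries.coeff_X, sub_eq_add_neg]

theorem multichoose_le_succ_pow (k m : ℕ) : Nat.multichoose k m ≤ (m + 1) ^ k := by
  induction k generalizing m with
  | zero => cases m <;> simp
  | succ k ih =>
    induction m with
    | zero => simp
    | succ m ihm =>
      rw [Nat.multichoose_succ_succ]
      calc _ ≤ (m + 1 + 1) ^ k + (m + 1) ^ (k + 1) := add_le_add (ih _) ihm
        _ ≤ (m + 1 + 1) ^ k + (m + 1 + 1) ^ k * (m + 1) := by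
            rw [pow_succ]; gcongr; omega
        _ = _ := by ring

theorem absSummableAt_binomSqSeries (k : ℕ) {r : ℝ} (h0 : 0 ≤ r) (h1 : r < 1) :
    AbsSummableAt (binomSqSeries k) r := by
  have h := summable_pow_mul_geometric_of_norm_lt_one (R := ℝ) (2 * k) (r := r)
    (by rwa [Real.norm_of_nonneg h0])
  have h' : Summable fun m : ℕ => ((m + 1 : ℕ) : ℝ) ^ (2 * k) * r ^ m := by
    rcases h0.eq_or_lt with rfl | hr
    · exact summable_of_ne_finset_zero (s := Finset.range 1) fun e he => by
        have : e ≠ 0 := by simpa using he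
        simp [this]
    · have := ((summable_nat_add_iff 1).mpr h).mul_right r⁻¹
      refine this.congr fun m => ?_
      rw [pow_succ]
      field_simp
  refine Summable.of_nonneg_of_le (fun _ => norm_nonneg _) (fun m => ?_) h'
  rw [Real.norm_of_nonneg (by simp only [binomSqSeries, PowerSeries.coeff_mk]; positivity)]
  simp only [binomSqSeries, PowerSeries.coeff_mk]
  gcongr
  rw [pow_mul']
  push_cast
  gcongr
  exact_mod_cast multichoose_le_succ_pow k m

theorem absSummableAt_quotSeries (k : ℕ) {r : ℝ} (h0 : 0 ≤ r) (h1 : r < 1) :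
    AbsSummableAt (quotSeries k) r :=
  (one_sub_X_pow_value r _).1.mul (absSummableAt_binomSqSeries k h0 h1)

theorem coeff_binomSqSeries_mul_inv_pow (k p m : ℕ) :
    ((PowerSeries.coeff m (binomSqSeries k) : ℤ) : ℝ) * (p : ℝ)⁻¹ ^ m = localTerm k p m := by
  simp only [binomSqSeries, PowerSeries.coeff_mk, localTerm, Nat.multichoose_eq, inv_pow]
  push_cast
  rfl

theorem inv_prime_lt_one {p : ℕ} (hp : p.Prime) : (p : ℝ)⁻¹ < 1 :=
  inv_lt_one_of_one_lt₀ (by exact_mod_cast hp.one_lt)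

theorem summable_localTerm (k : ℕ) {p : ℕ} (hp : p.Prime) : Summable (localTerm k p) := by
  have := (absSummableAt_binomSqSeries k (by positivity) (inv_prime_lt_one hp)).of_norm
  simpa only [coeff_binomSqSeries_mul_inv_pow] using this

theorem seriesValue_quotSeries (k : ℕ) {p : ℕ} (hp : p.Prime) :
    seriesValue (quotSeries k) (p : ℝ)⁻¹ = localFactor k p := by
  rw [quotSeries, seriesValue_mul (one_sub_X_pow_value _ _).1
    (absSummableAt_binomSqSeries k (by positivity) (inv_prime_lt_one hp)),
    (one_sub_X_pow_value _ _).2, localFactor, one_div, seriesValue]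
  simp only [coeff_binomSqSeries_mul_inv_pow]

/-! ### Absolute convergence of `∑ g(n)/n` and its Euler product -/

/-- A power series `1 + O(X²)` at `0 ≤ r ≤ 1/2`, with a constant that does not depend on `r`. For
`r = 1/p` this bounds the Euler factors uniformly in the prime `p`. -/
theorem norm_tsum_mul_pow_sub_one_le {c : ℕ → ℝ} (h0 : c 0 = 1) (h1 : c 1 = 0)
    (hc : Summable fun e => |c e| * (2⁻¹ : ℝ) ^ e) {r : ℝ} (hr0 : 0 ≤ r) (hr : r ≤ 2⁻¹) :
    ‖(∑' e, c e * r ^ e) - 1‖ ≤ (∑' e, |c (e + 2)| * (2⁻¹ : ℝ) ^ e) * r ^ 2 := by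
  have hs : Summable fun e => c e * r ^ e := by
    refine Summable.of_norm_bounded hc fun e => ?_
    rw [norm_mul, norm_pow, Real.norm_of_nonneg hr0, Real.norm_eq_abs]
    gcongr
  have hc2 : Summable fun e => |c (e + 2)| * (2⁻¹ : ℝ) ^ e := by
    refine (((summable_nat_add_iff 2).mpr hc).mul_right (2 ^ 2)).congr fun e => ?_
    rw [pow_add]; ring
  rw [← hs.sum_add_tsum_nat_add 2]
  simp only [Finset.sum_range_succ, Finset.sum_range_zero, h0, h1, pow_zero,
    zero_add, mul_one, zero_mul, add_zero, add_sub_cancel_left]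
  have h3 : ∀ e, ‖c (e + 2) * r ^ (e + 2)‖ ≤ |c (e + 2)| * (2⁻¹ : ℝ) ^ e * r ^ 2 := by
    intro e
    rw [norm_mul, norm_pow, Real.norm_of_nonneg hr0, Real.norm_eq_abs, pow_add, mul_assoc]
    gcongr
  have := tsum_of_norm_bounded (hc2.mul_right (r ^ 2)).hasSum h3
  rw [tsum_mul_right] at this
  exact this

/-- A convergence test for nonnegative multiplicative functions: the partial sums are at most the
partial Euler products, and these are at most `exp (∑ C/p²)`. -/
theorem summable_of_prime_pow_tsum_le {f : ℕ → ℝ} (hf : ∀ n, 0 ≤ f n) (h0 : f 0 = 0)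
    (h1 : f 1 = 1)
    (hmul : ∀ {m n : ℕ}, Nat.Coprime m n → f (m * n) = f m * f n)
    (hs : ∀ {p : ℕ}, p.Prime → Summable fun e : ℕ => f (p ^ e)) {C : ℝ} (hC : 0 ≤ C)
    (hle : ∀ p : ℕ, p.Prime → ∑' e : ℕ, f (p ^ e) ≤ 1 + C * ((p : ℝ) ^ 2)⁻¹) : Summable f := by
  have hsq : Summable fun n : ℕ => C * ((n : ℝ) ^ 2)⁻¹ :=
    (Real.summable_nat_pow_inv.mpr one_lt_two).mul_left C
  refine summable_of_sum_range_le (c := Real.exp (∑' n : ℕ, C * ((n : ℝ) ^ 2)⁻¹)) hf fun N => ?_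
  obtain ⟨-, hhas⟩ := EulerProduct.summable_and_hasSum_smoothNumbers_prod_primesBelow_tsum
    h1 hmul (fun {p} hp => (hs hp).norm) N
  calc ∑ n ∈ Finset.range N, f n
      = ∑ n ∈ Finset.range N, (N.smoothNumbers).indicator f n := by
        refine Finset.sum_congr rfl fun n hn => ?_
        rcases Nat.eq_zero_or_pos n with rfl | hpos
        · rw [h0, Set.indicator_apply]; split_ifs <;> simp [h0]
        · rw [Set.indicator_of_mem (Nat.mem_smoothNumbers_of_lt hpos (Finset.mem_range.mp hn))]
    _ ≤ ∑' n, (N.smoothNumbers).indicator f n := by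
        refine Summable.sum_le_tsum _ (fun n _ => Set.indicator_nonneg (fun n _ => hf n) n) ?_
        exact summable_subtype_iff_indicator.mp hhas.summable
    _ = ∏ p ∈ N.primesBelow, ∑' e : ℕ, f (p ^ e) := by
        rw [← tsum_subtype, hhas.tsum_eq]
    _ ≤ ∏ p ∈ N.primesBelow, Real.exp (C * ((p : ℝ) ^ 2)⁻¹) := by
        refine Finset.prod_le_prod (fun p _ => tsum_nonneg fun e => hf _) fun p hp => ?_
        refine (hle p (Nat.prime_of_mem_primesBelow hp)).trans ?_
        rw [add_comm]
        exact Real.add_one_le_exp _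
    _ = Real.exp (∑ p ∈ N.primesBelow, C * ((p : ℝ) ^ 2)⁻¹) := (Real.exp_sum _ _).symm
    _ ≤ _ := Real.exp_le_exp.mpr (hsq.sum_le_tsum _ fun n _ => by positivity)

theorem divisorSqQuot_prime_pow_div (k : ℕ) {p : ℕ} (hp : p.Prime) (e : ℕ) :
    (divisorSqQuot k (p ^ e) : ℝ) / ((p ^ e : ℕ) : ℝ) =
      ((PowerSeries.coeff e (quotSeries k) : ℤ) : ℝ) * (p : ℝ)⁻¹ ^ e := by
  rw [divisorSqQuot_prime_pow k hp, div_eq_mul_inv]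
  push_cast
  rw [inv_pow]

theorem divisorSqQuot_div_mul (k : ℕ) {m n : ℕ} (h : Nat.Coprime m n) :
    (divisorSqQuot k (m * n) : ℝ) / ((m * n : ℕ) : ℝ) =
      (divisorSqQuot k m : ℝ) / (m : ℝ) * ((divisorSqQuot k n : ℝ) / (n : ℝ)) := by
  rw [(isMultiplicative_divisorSqQuot k).map_mul_of_coprime h]
  push_cast
  rw [div_mul_div_comm]

theorem inv_prime_le_half {p : ℕ} (hp : p.Prime) : (p : ℝ)⁻¹ ≤ 2⁻¹ :=
  inv_anti₀ two_pos (by exact_mod_cast hp.two_le)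

theorem summable_abs_coeff_quotSeries (k : ℕ) :
    Summable fun e => |((PowerSeries.coeff e (quotSeries k) : ℤ) : ℝ)| * (2⁻¹ : ℝ) ^ e := by
  refine (absSummableAt_quotSeries k (r := 2⁻¹) (by norm_num) (by norm_num)).congr fun e => ?_
  rw [norm_mul, Real.norm_eq_abs, Real.norm_of_nonneg (by positivity)]

/-- Absolute convergence of `∑ g(n)/n`: the primes themselves do not contribute because
`g(p) = 0`. -/
theorem summable_divisorSqQuot_div (k : ℕ) :
    Summable fun n : ℕ => ‖(divisorSqQuot k n : ℝ) / (n : ℝ)‖ := by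
  refine summable_of_prime_pow_tsum_le
    (C := ∑' e, |((PowerSeries.coeff (e + 2) (quotSeries k) : ℤ) : ℝ)| * (2⁻¹ : ℝ) ^ e)
    (fun n => norm_nonneg _) (by simp) ?_ ?_ ?_ ?_ ?_
  · simp [(isMultiplicative_divisorSqQuot k).map_one]
  · intro m n h
    rw [divisorSqQuot_div_mul k h, norm_mul]
  · intro p hp
    simp only [divisorSqQuot_prime_pow_div k hp]
    exact absSummableAt_quotSeries k (by positivity) (inv_prime_lt_one hp)
  · exact tsum_nonneg fun e => by positivity
  · intro p hp
    have h := norm_tsum_mul_pow_sub_one_le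
      (c := fun e => |((PowerSeries.coeff e (quotSeries k) : ℤ) : ℝ)|)
      (by simp [coeff_zero_quotSeries, -PowerSeries.coeff_zero_eq_constantCoeff])
      (by simp [coeff_one_quotSeries])
      (by simpa only [abs_abs] using summable_abs_coeff_quotSeries k)
      (r := (p : ℝ)⁻¹) (by positivity) (inv_prime_le_half hp)
    simp only [abs_abs] at h
    have h' := (abs_le.mp (by simpa only [Real.norm_eq_abs] using h)).2
    simp only [divisorSqQuot_prime_pow_div k hp, norm_mul, Real.norm_eq_abs,
      abs_of_nonneg (show (0 : ℝ) ≤ (p : ℝ)⁻¹ ^ _ by positivity)]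
    rw [inv_pow] at h'
    linarith

theorem hasProd_localFactor (k : ℕ) :
    HasProd (fun p : Nat.Primes => localFactor k p)
      (∑' n : ℕ, (divisorSqQuot k n : ℝ) / (n : ℝ)) := by
  have h := EulerProduct.eulerProduct_hasProd (f := fun n : ℕ => (divisorSqQuot k n : ℝ) / (n : ℝ))
    (by simp [(isMultiplicative_divisorSqQuot k).map_one])
    (fun {m n} h => divisorSqQuot_div_mul k h) (summable_divisorSqQuot_div k) (by simp)
  have he : (fun p : Nat.Primes => localFactor k p) = fun p : Nat.Primes =>
      ∑' e : ℕ, (divisorSqQuot k ((p : ℕ) ^ e) : ℝ) / (((p : ℕ) ^ e : ℕ) : ℝ) := by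
    funext p
    rw [← seriesValue_quotSeries k p.2, seriesValue]
    simp only [divisorSqQuot_prime_pow_div k p.2]
  rw [he]
  exact h

theorem arithFactor_eq_tsum (k : ℕ) :
    arithFactor k = ∑' n : ℕ, (divisorSqQuot k n : ℝ) / (n : ℝ) :=
  (hasProd_localFactor k).tprod_eq

theorem localFactor_pos (k : ℕ) {p : ℕ} (hp : p.Prime) : 0 < localFactor k p := by
  have h1 : 0 < 1 - 1 / (p : ℝ) := by
    rw [one_div]; linarith [inv_prime_lt_one hp]
  have h2 : 0 < ∑' m : ℕ, localTerm k p m :=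
    (summable_localTerm k hp).tsum_pos (fun m => by unfold localTerm; positivity) 0
      (by simp [localTerm])
  unfold localFactor
  positivity

/-- The Euler product is absolutely convergent with nonzero factors, so it does not vanish. -/
theorem arithFactor_ne_zero (k : ℕ) : arithFactor k ≠ 0 := by
  have h := tprod_one_add_ne_zero_of_summable (f := fun p : Nat.Primes => localFactor k p - 1)
    (fun p => by simpa using (localFactor_pos k p.2).ne') ?_
  · simpa [arithFactor] using h
  · have hsq : Summable fun p : Nat.Primes =>
        (∑' e, |((PowerSeries.coeff (e + 2) (quotSeries k) : ℤ) : ℝ)| * (2⁻¹ : ℝ) ^ e) *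
          ((p : ℕ) : ℝ)⁻¹ ^ 2 := by
      refine Summable.mul_left _ ?_
      have : Summable fun n : ℕ => (n : ℝ)⁻¹ ^ 2 := by
        simpa only [inv_pow] using Real.summable_nat_pow_inv.mpr one_lt_two
      exact this.comp_injective Subtype.val_injective
    refine Summable.of_nonneg_of_le (fun _ => norm_nonneg _) (fun p => ?_) hsq
    rw [← seriesValue_quotSeries k p.2]
    exact norm_tsum_mul_pow_sub_one_le
      (by simp [coeff_zero_quotSeries, -PowerSeries.coeff_zero_eq_constantCoeff])
      (by simp [coeff_one_quotSeries]) (summable_abs_coeff_quotSeries k) (by positivity)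
      (inv_prime_le_half p.2)

/-! ### The Dirichlet series at `s = 1` -/

/-- The identity `d_k² = g * d_{k²}` over an arbitrary ring. -/
theorem divisorSq_cast_eq (R : Type*) [Ring R] (k : ℕ) :
    (divisorSq k : ArithmeticFunction R) =
      (divisorSqQuot k : ArithmeticFunction R) * (ζ : ArithmeticFunction R) ^ (k ^ 2) := by
  have h : ∀ n : ℕ, (((ζ : ArithmeticFunction ℤ) ^ n : ArithmeticFunction ℤ) :
      ArithmeticFunction R) = (ζ : ArithmeticFunction R) ^ n := by
    intro n
    induction n with
    | zero => rw [pow_zero, pow_zero, intCoe_one]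
    | succ n ih =>
      rw [pow_succ, pow_succ, intCoe_mul, ih]
      congr 1
      ext n
      simp
  rw [← divisorSqQuot_mul_zeta_pow, intCoe_mul, h]

theorem LSeries_zeta_pow {s : ℂ} (hs : 1 < s.re) (n : ℕ) :
    LSeriesSummable (fun m => ((ζ : ArithmeticFunction ℂ) ^ n) m) s ∧
      LSeries (fun m => ((ζ : ArithmeticFunction ℂ) ^ n) m) s = riemannZeta s ^ n := by
  have hz : LSeriesSummable (fun m => (ζ : ArithmeticFunction ℂ) m) s := by
    simpa only [natCoe_apply] using LSeriesSummable_zeta_iff.mpr hs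
  have hv : LSeries (fun m => (ζ : ArithmeticFunction ℂ) m) s = riemannZeta s := by
    simpa only [natCoe_apply] using LSeries_zeta_eq_riemannZeta hs
  induction n with
  | zero =>
    have h1 : (fun m => ((ζ : ArithmeticFunction ℂ) ^ 0) m) = LSeries.delta := by
      rw [pow_zero, ← one_eq_delta]
    rw [h1]
    refine ⟨?_, by rw [pow_zero, LSeries_delta]; rfl⟩
    exact summable_of_ne_finset_zero (s := {1}) fun n hn => by
      have : n ≠ 1 := by simpa using hn
      simp [LSeries.term_def, LSeries.delta, this]
  | succ n ih =>
    rw [pow_succ, pow_succ]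
    refine ⟨LSeriesSummable_mul ih.1 hz, ?_⟩
    rw [LSeries_mul' ih.1 hz, ih.2, hv]

/-- The Dirichlet series `G(s) = ∑ g(n) n^{-s}`. -/
noncomputable def quotLSeries (k : ℕ) (s : ℂ) : ℂ := LSeries (fun n => (divisorSqQuot k n : ℂ)) s

theorem LSeries_term_one (k n : ℕ) :
    LSeries.term (fun n => (divisorSqQuot k n : ℂ)) 1 n =
      (((divisorSqQuot k n : ℝ) / (n : ℝ) : ℝ) : ℂ) := by
  rw [LSeries.term_def]
  split_ifs with h
  · simp [h]
  · push_cast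
    rw [Complex.cpow_one]

theorem LSeriesSummable_divisorSqQuot (k : ℕ) {s : ℂ} (hs : 1 ≤ s.re) :
    LSeriesSummable (fun n => (divisorSqQuot k n : ℂ)) s := by
  refine LSeriesSummable.of_re_le_re (s := 1) (by simpa using hs) ?_
  unfold LSeriesSummable
  simp only [funext (LSeries_term_one k)]
  exact Complex.summable_ofReal.mpr (summable_divisorSqQuot_div k).of_norm

theorem quotLSeries_one (k : ℕ) : quotLSeries k 1 = (arithFactor k : ℂ) := by
  rw [quotLSeries, LSeries, arithFactor_eq_tsum, Complex.ofReal_tsum]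
  simp only [LSeries_term_one]

theorem continuousOn_quotLSeries (k : ℕ) : ContinuousOn (quotLSeries k) {s : ℂ | 1 ≤ s.re} := by
  unfold quotLSeries LSeries
  refine continuousOn_tsum (u := fun n => ‖LSeries.term (fun n => (divisorSqQuot k n : ℂ)) 1 n‖)
    (fun n => ?_) (LSeriesSummable_divisorSqQuot k (s := 1) (by simp)).norm fun n s hs => ?_
  · rcases eq_or_ne n 0 with rfl | hn
    · simpa only [LSeries.term_zero] using continuousOn_const
    · simp only [LSeries.term_of_ne_zero hn]
      have hn' : (n : ℂ) ≠ 0 := by exact_mod_cast hn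
      exact (continuous_const.div (continuous_id.const_cpow (Or.inl hn'))
        fun s => by simp [Complex.cpow_eq_zero_iff, hn']).continuousOn
  · exact LSeries.norm_term_le_of_re_le_re _ (by simpa using hs) n

theorem divisorSq_cast_apply (R : Type*) [Ring R] (k n : ℕ) :
    (divisorSq k : ArithmeticFunction R) n = (divisorK k n : R) ^ 2 := by
  rw [intCoe_apply, divisorSq_apply]
  push_cast
  rfl

/-- `F(s) = ζ(s)^{k²} G(s)` for `Re s > 1`. -/
theorem divisorSqSeries_eq (k : ℕ) {s : ℂ} (hs : 1 < s.re) :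
    LSeriesSummable (fun n => (divisorK k n : ℂ) ^ 2) s ∧
      divisorSqSeries k s = riemannZeta s ^ (k ^ 2) * quotLSeries k s := by
  have hg : LSeriesSummable (fun n => (divisorSqQuot k : ArithmeticFunction ℂ) n) s := by
    simpa only [intCoe_apply] using LSeriesSummable_divisorSqQuot k hs.le
  have hz := LSeries_zeta_pow hs (k ^ 2)
  have he : (fun n => (divisorK k n : ℂ) ^ 2) = fun n => ((divisorSqQuot k : ArithmeticFunction ℂ) *
      (ζ : ArithmeticFunction ℂ) ^ (k ^ 2)) n := by
    funext n
    rw [← divisorSq_cast_eq, divisorSq_cast_apply]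
  rw [divisorSqSeries, he]
  refine ⟨LSeriesSummable_mul hg hz.1, ?_⟩
  rw [LSeries_mul' hg hz.1, hz.2, mul_comm, quotLSeries]
  simp only [intCoe_apply]

theorem tendsto_quotLSeries (k : ℕ) :
    Tendsto (quotLSeries k) (𝓝[{s : ℂ | 1 < s.re}] 1) (𝓝 (arithFactor k : ℂ)) := by
  rw [← quotLSeries_one]
  refine ((continuousOn_quotLSeries k) 1 (by simp)).mono_left (nhdsWithin_mono _ fun s hs => ?_)
  exact (show 1 < s.re from hs).le

theorem tendsto_inv_zeta_mul_divisorSqSeries (k : ℕ) :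
    Tendsto (fun s : ℂ => (riemannZeta s ^ (k ^ 2))⁻¹ * divisorSqSeries k s)
      (𝓝[{s : ℂ | 1 < s.re}] 1) (𝓝 (arithFactor k : ℂ)) := by
  refine (tendsto_quotLSeries k).congr' ?_
  filter_upwards [self_mem_nhdsWithin] with s hs
  rw [(divisorSqSeries_eq k hs).2,
    inv_mul_cancel_left₀ (pow_ne_zero _ (riemannZeta_ne_zero_of_one_lt_re hs))]

theorem tendsto_sub_one_pow_mul_divisorSqSeries (k : ℕ) :
    Tendsto (fun s : ℂ => (s - 1) ^ (k ^ 2) * divisorSqSeries k s)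
      (𝓝[{s : ℂ | 1 < s.re}] 1) (𝓝 (arithFactor k : ℂ)) := by
  have hz : Tendsto (fun s : ℂ => (s - 1) * riemannZeta s) (𝓝[{s : ℂ | 1 < s.re}] 1) (𝓝 1) := by
    refine riemannZeta_residue_one.mono_left (nhdsWithin_mono _ fun s hs => ?_)
    rintro rfl
    simp at hs
  have h := (hz.pow (k ^ 2)).mul (tendsto_quotLSeries k)
  rw [one_pow, one_mul] at h
  refine h.congr' ?_
  filter_upwards [self_mem_nhdsWithin] with s hs
  rw [(divisorSqSeries_eq k hs).2, mul_pow, mul_assoc]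

/-! ### Logarithmic means of arithmetic functions -/

/-- The logarithmic summatory function `∑_{1 ≤ n ≤ x} f(n)/n`. -/
noncomputable def logSum (f : ArithmeticFunction ℝ) (x : ℝ) : ℝ :=
  ∑ n ∈ Finset.Ioc 0 ⌊x⌋₊, f n / n

theorem logSum_of_lt_one (f : ArithmeticFunction ℝ) {x : ℝ} (hx : x < 1) : logSum f x = 0 := by
  rw [logSum, Nat.floor_eq_zero.mpr hx]
  simp

theorem logSum_mul (f g : ArithmeticFunction ℝ) (x : ℝ) :
    logSum (f * g) x = ∑ n ∈ Finset.Ioc 0 ⌊x⌋₊, f n / n * logSum g (x / n) := by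
  let w : ArithmeticFunction ℝ → ArithmeticFunction ℝ := fun f => ⟨fun n => f n / n, by simp⟩
  have hw : ∀ f n, w f n = f n / n := fun _ _ => rfl
  have h : ∀ n, (w f * w g) n = (f * g) n / n := by
    intro n
    rw [mul_apply, mul_apply, Finset.sum_div]
    refine Finset.sum_congr rfl fun p hp => ?_
    rw [hw, hw, ← (Nat.mem_divisorsAntidiagonal.mp hp).1]
    push_cast
    rw [div_mul_div_comm]
  simp only [logSum, ← h, sum_Ioc_mul_eq_sum_sum, hw, Nat.floor_div_natCast]

theorem pow_succ_sub_pow_succ_bounds {a b : ℝ} (hb : 0 ≤ b) (hab : b ≤ a) (n : ℕ) :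
    (n + 1) * (a - b) * b ^ n ≤ a ^ (n + 1) - b ^ (n + 1) ∧
      a ^ (n + 1) - b ^ (n + 1) ≤ (n + 1) * (a - b) * a ^ n := by
  have hd : 0 ≤ a - b := sub_nonneg.mpr hab
  have ha : 0 ≤ a := hb.trans hab
  induction n with
  | zero => simp
  | succ n ih =>
    have e : a ^ (n + 1 + 1) - b ^ (n + 1 + 1) =
        a * (a ^ (n + 1) - b ^ (n + 1)) + (a - b) * b ^ (n + 1) := by ring
    rw [e]
    push_cast
    constructor
    · have h1 : b * ((n + 1) * (a - b) * b ^ n) ≤ a * (a ^ (n + 1) - b ^ (n + 1)) :=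
        mul_le_mul hab ih.1 (by positivity) ha
      calc _ = b * ((n + 1) * (a - b) * b ^ n) + (a - b) * b ^ (n + 1) := by ring
        _ ≤ _ := by gcongr
    · have h1 := mul_le_mul_of_nonneg_left ih.2 ha
      have h2 : (a - b) * b ^ (n + 1) ≤ (a - b) * a ^ (n + 1) := by gcongr
      calc _ ≤ a * ((n + 1) * (a - b) * a ^ n) + (a - b) * a ^ (n + 1) := add_le_add h1 h2
        _ = _ := by ring

/-- Comparison of `∑_{m ≤ x} log(x/m)^n / m` with a telescoping sum, from below. -/
theorem log_pow_le_sum {x : ℝ} (hx : 1 ≤ x) (n : ℕ) :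
    Real.log x ^ (n + 1) ≤
      (n + 1) * ∑ i ∈ Finset.range ⌊x⌋₊, 1 / ((i : ℝ) + 1) * Real.log (x / (i + 1)) ^ n := by
  have hx0 : 0 < x := by linarith
  -- the truncation at `0` makes the telescoping sum end exactly at `0`, because
  -- `x < ⌊x⌋₊ + 1`
  let L : ℕ → ℝ := fun i => max (Real.log (x / (i + 1))) 0
  have hL0 : L 0 = Real.log x := by simp [L, Real.log_nonneg hx]
  have hLN : L ⌊x⌋₊ = 0 := by
    refine max_eq_right (Real.log_nonpos (by positivity) ?_)
    rw [div_le_one (by positivity)]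
    exact (Nat.lt_floor_add_one x).le
  have h := Finset.sum_range_sub' (fun i => L i ^ (n + 1)) ⌊x⌋₊
  rw [hL0, hLN, zero_pow (Nat.succ_ne_zero n), sub_zero] at h
  rw [← h, Finset.mul_sum]
  refine Finset.sum_le_sum fun i hi => ?_
  have hi' : (i : ℝ) + 1 ≤ x := by
    have : i + 1 ≤ ⌊x⌋₊ := Finset.mem_range.mp hi
    exact_mod_cast (Nat.le_floor_iff hx0.le).mp this
  have hLi : L i = Real.log (x / (i + 1)) :=
    max_eq_left (Real.log_nonneg (by rwa [one_le_div (by positivity)]))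
  have hsplit : Real.log (x / (((i + 1 : ℕ) : ℝ) + 1)) =
      Real.log (x / (i + 1)) - Real.log (((i : ℝ) + 2) / (i + 1)) := by
    rw [← Real.log_div (by positivity) (by positivity)]
    congr 1
    push_cast
    field_simp
    ring
  have hlog : Real.log (((i : ℝ) + 2) / (i + 1)) ≤ 1 / ((i : ℝ) + 1) := by
    refine (Real.log_le_sub_one_of_pos (by positivity)).trans (le_of_eq ?_)
    field_simp
    ring
  have hlog0 : 0 ≤ Real.log (((i : ℝ) + 2) / (i + 1)) :=
    Real.log_nonneg (by rw [one_le_div (by positivity)]; linarith)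
  have hle : L (i + 1) ≤ L i := by
    refine max_le ?_ (le_max_right _ _)
    rw [hsplit, hLi]
    linarith
  have hdiff : L i - L (i + 1) ≤ 1 / ((i : ℝ) + 1) := by
    have : Real.log (x / (((i + 1 : ℕ) : ℝ) + 1)) ≤ L (i + 1) := le_max_left _ _
    rw [hsplit] at this
    rw [hLi]
    linarith
  refine (pow_succ_sub_pow_succ_bounds (le_max_right _ _) hle n).2.trans ?_
  rw [← hLi, mul_assoc]
  have : 0 ≤ L i := le_max_right _ _
  gcongr

/-- Comparison of `∑_{m ≤ x} (log(x/m) + c)^n / m` with a telescoping sum, from above. -/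
theorem sum_log_add_pow_le {x : ℝ} (hx : 1 ≤ x) {c : ℝ} (hc : 0 ≤ c) (n : ℕ) :
    (n + 1) * ∑ i ∈ Finset.range ⌊x⌋₊, 1 / ((i : ℝ) + 1) * (Real.log (x / (i + 1)) + c) ^ n ≤
      (Real.log x + c + 1) ^ (n + 1) := by
  have hx0 : 0 < x := by linarith
  let L : ℕ → ℝ := fun i => Real.log (x / (i + 1)) + c
  have hL0 : L 0 = Real.log x + c := by simp [L]
  have hpos : ∀ i < ⌊x⌋₊, 0 ≤ L i := by
    intro i hi
    have hi' : (i : ℝ) + 1 ≤ x := by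
      have : i + 1 ≤ ⌊x⌋₊ := hi
      exact_mod_cast (Nat.le_floor_iff hx0.le).mp this
    exact add_nonneg (Real.log_nonneg (by rwa [one_le_div (by positivity)])) hc
  obtain ⟨N, hN⟩ : ∃ N, ⌊x⌋₊ = N + 1 :=
    Nat.exists_eq_succ_of_ne_zero (Nat.floor_pos.mpr hx).ne'
  have hstep : ∀ i < N, (n + 1) * (1 / (((i + 1 : ℕ) : ℝ) + 1) * L (i + 1) ^ n) ≤
      L i ^ (n + 1) - L (i + 1) ^ (n + 1) := by
    intro i hi
    have hLi := hpos (i + 1) (by omega)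
    have hsplit : L i - L (i + 1) = Real.log (((i : ℝ) + 2) / (i + 1)) := by
      have : Real.log (x / (i + 1)) - Real.log (x / (((i + 1 : ℕ) : ℝ) + 1)) =
          Real.log (((i : ℝ) + 2) / (i + 1)) := by
        rw [← Real.log_div (by positivity) (by positivity)]
        congr 1
        push_cast
        field_simp
        ring
      simp only [L]
      linarith
    have hlog : 1 / (((i + 1 : ℕ) : ℝ) + 1) ≤ Real.log (((i : ℝ) + 2) / (i + 1)) := by
      refine le_trans (le_of_eq ?_) (Real.one_sub_inv_le_log_of_pos (by positivity))
      push_cast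
      field_simp
      ring
    have hle : L (i + 1) ≤ L i := by
      have : 0 ≤ 1 / (((i + 1 : ℕ) : ℝ) + 1) := by positivity
      linarith
    refine le_trans ?_ (pow_succ_sub_pow_succ_bounds hLi hle n).1
    rw [hsplit, mul_assoc]
    gcongr
  have hu : 0 ≤ Real.log x + c := hL0 ▸ hpos 0 (by omega)
  have htel := Finset.sum_le_sum fun i hi => hstep i (Finset.mem_range.mp hi)
  rw [Finset.sum_range_sub' (fun i => L i ^ (n + 1)), hL0, ← Finset.mul_sum] at htel
  have hLN : 0 ≤ L N ^ (n + 1) := pow_nonneg (hpos N (by omega)) _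
  have hlast := (pow_succ_sub_pow_succ_bounds hu (by linarith : Real.log x + c ≤
    Real.log x + c + 1) n).1
  have e0 : 1 / (((0 : ℕ) : ℝ) + 1) * L 0 ^ n = (Real.log x + c) ^ n := by
    rw [hL0]; simp
  rw [hN, Finset.sum_range_succ' (fun i : ℕ => 1 / ((i : ℝ) + 1) * L i ^ n), e0, mul_add]
  have e1 : Real.log x + c + 1 - (Real.log x + c) = 1 := by ring
  rw [e1, mul_one] at hlast
  linarith

theorem sum_Ioc_zero_eq_sum_range (F : ℕ → ℝ) (N : ℕ) :
    ∑ n ∈ Finset.Ioc 0 N, F n = ∑ i ∈ Finset.range N, F (i + 1) := by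
  rw [Finset.range_eq_Ico, Finset.sum_Ico_add' F 0 N 1]
  rfl

/-- The logarithmic mean of `d_n` is `log^n x / n!` up to lower order terms. By induction on `n`,
since `d_{n+1} = 1 * d_n`. -/
theorem logSum_zeta_pow_bounds (n : ℕ) {x : ℝ} (hx : 1 ≤ x) :
    Real.log x ^ n ≤ n ! * logSum ((ζ : ArithmeticFunction ℝ) ^ n) x ∧
      n ! * logSum ((ζ : ArithmeticFunction ℝ) ^ n) x ≤ (Real.log x + n) ^ n := by
  induction n generalizing x with
  | zero =>
    have : logSum (1 : ArithmeticFunction ℝ) x = 1 := by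
      rw [logSum, Finset.sum_eq_single 1]
      · simp
      · intro b _ hb
        simp [one_apply_ne hb]
      · intro h
        exact absurd (Finset.mem_Ioc.mpr ⟨zero_lt_one, Nat.one_le_floor_iff x |>.mpr hx⟩) h
    simp [this]
  | succ n ih =>
    have hrec : logSum ((ζ : ArithmeticFunction ℝ) ^ (n + 1)) x = ∑ i ∈ Finset.range ⌊x⌋₊,
        1 / ((i : ℝ) + 1) * logSum ((ζ : ArithmeticFunction ℝ) ^ n) (x / (i + 1)) := by
      rw [pow_succ', logSum_mul, sum_Ioc_zero_eq_sum_range]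
      refine Finset.sum_congr rfl fun i _ => ?_
      simp [natCoe_apply]
    have hxi : ∀ i ∈ Finset.range ⌊x⌋₊, 1 ≤ x / ((i : ℝ) + 1) := by
      intro i hi
      have : i + 1 ≤ ⌊x⌋₊ := Finset.mem_range.mp hi
      rw [one_le_div (by positivity)]
      exact_mod_cast (Nat.le_floor_iff (by linarith)).mp this
    have hfac : ((n + 1)! : ℝ) * logSum ((ζ : ArithmeticFunction ℝ) ^ (n + 1)) x =
        (n + 1) * ∑ i ∈ Finset.range ⌊x⌋₊, 1 / ((i : ℝ) + 1) *
          (n ! * logSum ((ζ : ArithmeticFunction ℝ) ^ n) (x / (i + 1))) := by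
      rw [hrec, Nat.factorial_succ, Finset.mul_sum, Finset.mul_sum]
      refine Finset.sum_congr rfl fun i _ => ?_
      push_cast
      ring
    rw [hfac]
    constructor
    · refine (log_pow_le_sum hx n).trans ?_
      gcongr with i hi
      exact (ih (hxi i hi)).1
    · have h := sum_log_add_pow_le hx (Nat.cast_nonneg (α := ℝ) n) n
      push_cast
      rw [← add_assoc]
      refine le_trans ?_ h
      gcongr with i hi
      exact (ih (hxi i hi)).2

theorem logSum_zeta_pow_nonneg (n : ℕ) (x : ℝ) :
    0 ≤ logSum ((ζ : ArithmeticFunction ℝ) ^ n) x := by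
  rcases lt_or_ge x 1 with h | h
  · rw [logSum_of_lt_one _ h]
  · exact nonneg_of_mul_nonneg_right
      ((pow_nonneg (Real.log_nonneg h) n).trans (logSum_zeta_pow_bounds n h).1) (by positivity)

theorem tendsto_one_add_div_log_pow (c : ℝ) (n : ℕ) :
    Tendsto (fun x : ℝ => (1 + c / Real.log x) ^ n) atTop (𝓝 1) := by
  have h := ((Real.tendsto_log_atTop.const_div_atTop c).const_add 1).pow n
  simpa using h

theorem tendsto_logSum_zeta_pow_div (n : ℕ) {m : ℕ} (hm : 1 ≤ m) :
    Tendsto (fun x : ℝ => logSum ((ζ : ArithmeticFunction ℝ) ^ n) (x / m) / Real.log x ^ n) atTop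
      (𝓝 (1 / (n ! : ℝ))) := by
  have hm0 : (0 : ℝ) < m := by exact_mod_cast hm
  have h1 := (tendsto_one_add_div_log_pow (-Real.log m) n).div_const (n ! : ℝ)
  have h2 := (tendsto_one_add_div_log_pow (n - Real.log m) n).div_const (n ! : ℝ)
  have hf : (0 : ℝ) < n ! := by positivity
  refine tendsto_of_tendsto_of_tendsto_of_le_of_le' h1 h2 ?_ ?_
  all_goals
    filter_upwards [eventually_ge_atTop (m : ℝ), eventually_gt_atTop 1] with x hxm hx1
    have hl : 0 < Real.log x := Real.log_pos hx1
    have hb := logSum_zeta_pow_bounds n (x := x / m) (by rwa [one_le_div hm0])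
    rw [Real.log_div (by positivity) hm0.ne'] at hb
  · rw [div_le_div_iff₀ hf (by positivity), ← mul_pow, mul_comm _ (n ! : ℝ)]
    refine le_trans (le_of_eq ?_) hb.1
    congr 1
    field_simp
    ring
  · rw [div_le_div_iff₀ (by positivity) hf, ← mul_pow, mul_comm _ (n ! : ℝ)]
    refine hb.2.trans (le_of_eq ?_)
    congr 1
    field_simp
    ring

/-- The logarithmic mean of `d_k²`: convolving with the absolutely convergent `g` multiplies the
logarithmic mean of `d_{k²}` by `∑ g(n)/n = a_k`. -/
theorem tendsto_logSum_divisorSq_div (k : ℕ) :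
    Tendsto (fun x : ℝ => logSum (divisorSq k : ArithmeticFunction ℝ) x / Real.log x ^ (k ^ 2))
      atTop (𝓝 (arithFactor k / ((k ^ 2)! : ℝ))) := by
  set K := k ^ 2 with hK
  have hf : (0 : ℝ) < K ! := by positivity
  have hexp : ∀ x : ℝ, logSum (divisorSq k : ArithmeticFunction ℝ) x / Real.log x ^ K =
      ∑' n : ℕ, (divisorSqQuot k n : ℝ) / n *
        (logSum ((ζ : ArithmeticFunction ℝ) ^ K) (x / n) / Real.log x ^ K) := by
    intro x
    rw [divisorSq_cast_eq ℝ k, logSum_mul, Finset.sum_div, tsum_eq_sum]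
    · exact Finset.sum_congr rfl fun n _ => by rw [intCoe_apply, mul_div_assoc]
    · intro n hn
      rcases Nat.eq_zero_or_pos n with rfl | hpos
      · simp
      · have hlt : ⌊x⌋₊ < n := by
          by_contra h
          exact hn (Finset.mem_Ioc.mpr ⟨hpos, not_lt.mp h⟩)
        rw [logSum_of_lt_one, zero_div, mul_zero]
        rw [div_lt_one (by exact_mod_cast hpos)]
        exact Nat.lt_of_floor_lt hlt
  simp only [hexp]
  have hlim : arithFactor k / (K ! : ℝ) =
      ∑' n : ℕ, (divisorSqQuot k n : ℝ) / n * (1 / (K ! : ℝ)) := by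
    rw [tsum_mul_right, ← arithFactor_eq_tsum, mul_one_div]
  rw [hlim]
  refine tendsto_tsum_of_dominated_convergence
    (bound := fun n => ‖(divisorSqQuot k n : ℝ) / n‖ * ((1 + K) ^ K / (K ! : ℝ)))
    ((summable_divisorSqQuot_div k).mul_right _) (fun n => ?_) ?_
  · rcases Nat.eq_zero_or_pos n with rfl | hpos
    · simp
    · exact (tendsto_logSum_zeta_pow_div K hpos).const_mul _
  · filter_upwards [eventually_ge_atTop (Real.exp 1)] with x hx n
    have hl : 1 ≤ Real.log x := by
      rw [← Real.log_exp 1]; exact Real.log_le_log (Real.exp_pos 1) hx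
    have hx1 : 0 ≤ x := (Real.exp_pos 1).le.trans hx
    rw [norm_mul]
    gcongr
    rw [Real.norm_of_nonneg (div_nonneg (logSum_zeta_pow_nonneg _ _) (by positivity)),
      div_le_div_iff₀ (by positivity) hf, mul_comm _ (K ! : ℝ), ← mul_pow]
    rcases lt_or_ge (x / n) 1 with h | h
    · rw [logSum_of_lt_one _ h, mul_zero]; positivity
    · refine (logSum_zeta_pow_bounds K h).2.trans ?_
      have hn1 : x / n ≤ x := by
        rcases Nat.eq_zero_or_pos n with rfl | hpos
        · simpa using hx1
        · exact div_le_self hx1 (by exact_mod_cast hpos)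
      have h0 := Real.log_nonneg h
      have := Real.log_le_log (by linarith) hn1
      gcongr
      nlinarith [Nat.cast_nonneg (α := ℝ) K]

/-! ### Mean values of Dirichlet polynomials -/

/-- The squared modulus `|∑_{n ∈ s} c_n n^{-it}|²` for real coefficients `c`, as the sum of the
squares of its real and imaginary parts. -/
noncomputable def polySq (s : Finset ℕ) (c : ℕ → ℝ) (t : ℝ) : ℝ :=
  (∑ n ∈ s, c n * Real.cos (t * Real.log n)) ^ 2 + (∑ n ∈ s, c n * Real.sin (t * Real.log n)) ^ 2

theorem polySq_nonneg (s : Finset ℕ) (c : ℕ → ℝ) (t : ℝ) : 0 ≤ polySq s c t := by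
  unfold polySq; positivity

theorem continuous_polySq (s : Finset ℕ) (c : ℕ → ℝ) : Continuous (polySq s c) := by
  unfold polySq; fun_prop

theorem polySq_eq_sum (s : Finset ℕ) (c : ℕ → ℝ) (t : ℝ) : polySq s c t =
    ∑ m ∈ s, ∑ n ∈ s, c m * c n * Real.cos ((Real.log m - Real.log n) * t) := by
  rw [polySq, sq, sq, Finset.sum_mul_sum, Finset.sum_mul_sum, ← Finset.sum_add_distrib]
  refine Finset.sum_congr rfl fun m _ => ?_
  rw [← Finset.sum_add_distrib]
  refine Finset.sum_congr rfl fun n _ => ?_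
  rw [sub_mul, Real.cos_sub, mul_comm (Real.log m) t, mul_comm (Real.log n) t]
  ring

theorem integral_mul_polySq {w : ℝ → ℝ} (hw : Continuous w) (R : ℝ) (s : Finset ℕ) (c : ℕ → ℝ) :
    ∫ t in (0 : ℝ)..R, w t * polySq s c t = ∑ m ∈ s, ∑ n ∈ s, c m * c n *
      ∫ t in (0 : ℝ)..R, w t * Real.cos ((Real.log m - Real.log n) * t) := by
  have e : ∀ t, w t * polySq s c t = ∑ m ∈ s, ∑ n ∈ s,
      c m * c n * (w t * Real.cos ((Real.log m - Real.log n) * t)) := by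
    intro t
    rw [polySq_eq_sum, Finset.mul_sum]
    refine Finset.sum_congr rfl fun m _ => ?_
    rw [Finset.mul_sum]
    exact Finset.sum_congr rfl fun n _ => by ring
  simp only [e]
  rw [intervalIntegral.integral_finsetSum]
  · refine Finset.sum_congr rfl fun m _ => ?_
    rw [intervalIntegral.integral_finsetSum]
    · exact Finset.sum_congr rfl fun n _ => intervalIntegral.integral_const_mul _ _
    · intro n _
      exact Continuous.intervalIntegrable (by fun_prop) _ _
  · intro m _
    exact Continuous.intervalIntegrable (by fun_prop) _ _

/-- Schur's test for a quadratic form whose diagonal entries all equal `D`. -/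
theorem abs_quadraticForm_sub_diag_le (s : Finset ℕ) (c : ℕ → ℝ) (κ β : ℕ → ℕ → ℝ) {D B : ℝ}
    (hdiag : ∀ m ∈ s, κ m m = D) (hκ : ∀ m ∈ s, ∀ n ∈ s, m ≠ n → |κ m n| ≤ β m n)
    (hβ : ∀ m n, β m n = β n m) (hB : ∀ m ∈ s, ∑ n ∈ s.erase m, β m n ≤ B) :
    |(∑ m ∈ s, ∑ n ∈ s, c m * c n * κ m n) - D * ∑ n ∈ s, c n ^ 2| ≤ B * ∑ n ∈ s, c n ^ 2 := by
  have e1 : (∑ m ∈ s, ∑ n ∈ s, c m * c n * κ m n) - D * ∑ n ∈ s, c n ^ 2 =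
      ∑ m ∈ s, ∑ n ∈ s.erase m, c m * c n * κ m n := by
    rw [Finset.mul_sum, ← Finset.sum_sub_distrib]
    refine Finset.sum_congr rfl fun m hm => ?_
    rw [← Finset.add_sum_erase s _ hm, hdiag m hm]
    ring
  have hswap : ∑ m ∈ s, ∑ n ∈ s.erase m, c n ^ 2 * β m n =
      ∑ m ∈ s, ∑ n ∈ s.erase m, c m ^ 2 * β m n := by
    rw [Finset.sum_comm' (s' := fun n => s.erase n) (t' := s)]
    · exact Finset.sum_congr rfl fun m _ => Finset.sum_congr rfl fun n _ => by rw [hβ]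
    · intro m n
      simp only [Finset.mem_erase]
      tauto
  rw [e1]
  calc |∑ m ∈ s, ∑ n ∈ s.erase m, c m * c n * κ m n|
      ≤ ∑ m ∈ s, ∑ n ∈ s.erase m, (c m ^ 2 * β m n + c n ^ 2 * β m n) / 2 := by
        refine (Finset.abs_sum_le_sum_abs _ _).trans (Finset.sum_le_sum fun m hm => ?_)
        refine (Finset.abs_sum_le_sum_abs _ _).trans (Finset.sum_le_sum fun n hn => ?_)
        obtain ⟨hne, hns⟩ := Finset.mem_erase.mp hn
        have h := hκ m hm n hns hne.symm
        rw [abs_mul, abs_mul]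
        have h2 : |c m| * |c n| ≤ (c m ^ 2 + c n ^ 2) / 2 := by
          rw [← sq_abs (c m), ← sq_abs (c n)]
          nlinarith [sq_nonneg (|c m| - |c n|)]
        calc _ ≤ (c m ^ 2 + c n ^ 2) / 2 * β m n := by gcongr
          _ = _ := by ring
    _ = ∑ m ∈ s, c m ^ 2 * ∑ n ∈ s.erase m, β m n := by
        simp only [← Finset.sum_div, Finset.sum_add_distrib, hswap, add_self_div_two,
          Finset.mul_sum]
    _ ≤ ∑ m ∈ s, c m ^ 2 * B := by
        gcongr with m hm
        exact hB m hm
    _ = _ := by rw [← Finset.sum_mul, mul_comm]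

theorem sum_erase_abs_sub_le {w : ℝ → ℝ} (hw : ∀ x, 0 ≤ x → 0 ≤ w x) {s : Finset ℕ} {N : ℕ}
    (hs : ∀ n ∈ s, n ≤ N) {m : ℕ} (hm : m ∈ s) :
    ∑ n ∈ s.erase m, w |(m : ℝ) - n| ≤ 2 * ∑ j ∈ Finset.range N, w ((j : ℝ) + 1) := by
  have hmN := hs m hm
  have hsub : s.erase m ⊆ Finset.range m ∪ Finset.Ico (m + 1) (N + 1) := by
    intro n hn
    obtain ⟨h1, h2⟩ := Finset.mem_erase.mp hn
    have := hs n h2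
    simp only [Finset.mem_union, Finset.mem_range, Finset.mem_Ico]
    omega
  have hdisj : Disjoint (Finset.range m) (Finset.Ico (m + 1) (N + 1)) := by
    rw [Finset.disjoint_left]
    intro n h1 h2
    simp only [Finset.mem_range, Finset.mem_Ico] at h1 h2
    omega
  have hmono : ∀ M ≤ N, ∑ j ∈ Finset.range M, w ((j : ℝ) + 1) ≤
      ∑ j ∈ Finset.range N, w ((j : ℝ) + 1) := fun M hM =>
    Finset.sum_le_sum_of_subset_of_nonneg (Finset.range_mono hM)
      fun j _ _ => hw _ (by positivity)
  have h1 : ∑ n ∈ Finset.range m, w |(m : ℝ) - n| = ∑ j ∈ Finset.range m, w ((j : ℝ) + 1) := by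
    rw [← Finset.sum_range_reflect]
    refine Finset.sum_congr rfl fun j hj => ?_
    have hj' := Finset.mem_range.mp hj
    have : ((m - 1 - j : ℕ) : ℝ) = m - 1 - j := by
      rw [Nat.sub_sub, Nat.cast_sub (by omega)]; push_cast; ring
    rw [this, abs_of_nonneg] <;> ring_nf
    positivity
  have h2 : ∑ n ∈ Finset.Ico (m + 1) (N + 1), w |(m : ℝ) - n| =
      ∑ j ∈ Finset.range (N - m), w ((j : ℝ) + 1) := by
    rw [Finset.sum_Ico_eq_sum_range, Nat.add_sub_add_right]
    refine Finset.sum_congr rfl fun j _ => ?_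
    have : (m : ℝ) - ((m + 1 + j : ℕ) : ℝ) = -((j : ℝ) + 1) := by push_cast; ring
    rw [this, abs_neg, abs_of_nonneg (by positivity)]
  calc ∑ n ∈ s.erase m, w |(m : ℝ) - n|
      ≤ ∑ n ∈ Finset.range m ∪ Finset.Ico (m + 1) (N + 1), w |(m : ℝ) - n| :=
        Finset.sum_le_sum_of_subset_of_nonneg hsub fun _ _ _ => hw _ (abs_nonneg _)
    _ ≤ _ := by
        rw [Finset.sum_union hdisj, h1, h2, two_mul]
        exact add_le_add (hmono m hmN) (hmono _ (by omega))

/-- Spacing of the frequencies `log n`, `n ≤ X`. -/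
theorem abs_sub_div_le_abs_log_sub {X : ℝ} {m n : ℕ} (hm : 1 ≤ m) (hn : 1 ≤ n) (hmX : (m : ℝ) ≤ X)
    (hnX : (n : ℝ) ≤ X) : |(m : ℝ) - n| / X ≤ |Real.log m - Real.log n| := by
  wlog h : n ≤ m generalizing m n
  · rw [abs_sub_comm, abs_sub_comm (Real.log m)]
    exact this hn hm hnX hmX (by omega)
  have hm0 : (0 : ℝ) < m := by exact_mod_cast hm
  have hn0 : (0 : ℝ) < n := by exact_mod_cast hn
  have hnm : (n : ℝ) ≤ m := by exact_mod_cast h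
  rw [abs_of_nonneg (sub_nonneg.mpr hnm)]
  refine le_trans ?_ (le_abs_self _)
  rw [← Real.log_div hm0.ne' hn0.ne']
  refine le_trans ?_ (Real.one_sub_inv_le_log_of_pos (by positivity))
  calc ((m : ℝ) - n) / X ≤ (m - n) / m :=
        div_le_div_of_nonneg_left (sub_nonneg.mpr hnm) hm0 hmX
    _ = _ := by field_simp

theorem integral_cos_mul {ξ : ℝ} (hξ : ξ ≠ 0) (T : ℝ) :
    ∫ t in (0 : ℝ)..T, Real.cos (ξ * t) = Real.sin (ξ * T) / ξ := by
  rw [intervalIntegral.integral_comp_mul_left _ hξ, integral_cos]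
  simp [div_eq_inv_mul]

/-- The Fourier transform of the triangular weight `1 - t/R`. -/
theorem integral_triangle_mul_cos {ξ R : ℝ} (hξ : ξ ≠ 0) (hR : R ≠ 0) :
    ∫ t in (0 : ℝ)..R, (1 - t / R) * Real.cos (ξ * t) = (1 - Real.cos (ξ * R)) / (R * ξ ^ 2) := by
  have hd : ∀ t ∈ Set.uIcc (0 : ℝ) R, HasDerivAt
      (fun t => (1 - t / R) * (Real.sin (ξ * t) / ξ) - Real.cos (ξ * t) / (R * ξ ^ 2))
      ((1 - t / R) * Real.cos (ξ * t)) t := by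
    intro t _
    have h0 : HasDerivAt (fun t : ℝ => ξ * t) ξ t := by
      simpa using (hasDerivAt_id t).const_mul ξ
    have h1 : HasDerivAt (fun t : ℝ => 1 - t / R) (-(1 / R)) t := by
      simpa using ((hasDerivAt_id t).div_const R).const_sub 1
    have h2 := h1.mul (h0.sin.div_const ξ)
    have h3 := h2.sub (h0.cos.div_const (R * ξ ^ 2))
    refine h3.congr_deriv ?_
    field_simp
    ring
  rw [intervalIntegral.integral_eq_sub_of_hasDerivAt hd
    (Continuous.intervalIntegrable (by fun_prop) _ _)]
  field_simp
  simp
  ring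

theorem sum_range_inv_sq_le (N : ℕ) :
    ∑ j ∈ Finset.range N, 1 / ((j : ℝ) + 1) ^ 2 ≤ 2 - 1 / (N : ℝ) := by
  induction N with
  | zero => simp
  | succ N ih =>
    rw [Finset.sum_range_succ]
    rcases Nat.eq_zero_or_pos N with rfl | hN
    · norm_num
    · have hN' : (0 : ℝ) < N := by exact_mod_cast hN
      have : 1 / ((N : ℝ) + 1) ^ 2 ≤ 1 / N - 1 / (N + 1) := by
        rw [div_sub_div _ _ hN'.ne' (by positivity),
          div_le_div_iff₀ (by positivity) (by positivity)]
        nlinarith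
      push_cast
      linarith

theorem sum_range_inv_le (N : ℕ) :
    ∑ j ∈ Finset.range N, 1 / ((j : ℝ) + 1) ≤ 1 + Real.log N := by
  have h := harmonic_le_one_add_log N
  rw [harmonic] at h
  push_cast at h
  simpa only [one_div] using h

/-- The mean value theorem for short Dirichlet polynomials: the off-diagonal terms are bounded
trivially, at the cost of a logarithm. -/
theorem abs_integral_polySq_sub_le {T X : ℝ} (hX : 1 ≤ X) {s : Finset ℕ}
    (hs : ∀ n ∈ s, 1 ≤ n ∧ (n : ℝ) ≤ X) (c : ℕ → ℝ) :
    |(∫ t in (0 : ℝ)..T, polySq s c t) - T * ∑ n ∈ s, c n ^ 2| ≤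
      2 * X * (1 + Real.log X) * ∑ n ∈ s, c n ^ 2 := by
  have hX0 : 0 < X := by linarith
  have h := integral_mul_polySq (w := fun _ => 1) continuous_const T s c
  simp only [one_mul] at h
  rw [h]
  refine abs_quadraticForm_sub_diag_le s c
    (fun m n => ∫ t in (0 : ℝ)..T, Real.cos ((Real.log m - Real.log n) * t))
    (fun m n => X / |(m : ℝ) - n|) (fun m _ => by simp) ?_ (fun m n => by rw [abs_sub_comm]) ?_
  · intro m hm n hn hmn
    have hsp := abs_sub_div_le_abs_log_sub (hs m hm).1 (hs n hn).1 (hs m hm).2 (hs n hn).2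
    have hmn' : 0 < |(m : ℝ) - n| := abs_pos.mpr (sub_ne_zero.mpr (by exact_mod_cast hmn))
    have hpos : 0 < |Real.log m - Real.log n| := lt_of_lt_of_le (by positivity) hsp
    rw [integral_cos_mul (abs_pos.mp hpos), abs_div]
    calc _ ≤ 1 / |Real.log m - Real.log n| := by
          gcongr; exact Real.abs_sin_le_one _
      _ ≤ 1 / (|(m : ℝ) - n| / X) := by gcongr
      _ = _ := by rw [one_div_div]
  · intro m hm
    have h1 := sum_erase_abs_sub_le (w := fun x => X / x) (fun x hx => by positivity)
      (N := ⌊X⌋₊) (fun n hn => Nat.le_floor (hs n hn).2) hm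
    refine h1.trans ?_
    have h2 := sum_range_inv_le ⌊X⌋₊
    have h3 : Real.log ⌊X⌋₊ ≤ Real.log X :=
      Real.log_le_log (by exact_mod_cast Nat.floor_pos.mpr hX) (Nat.floor_le hX0.le)
    calc 2 * ∑ j ∈ Finset.range ⌊X⌋₊, X / ((j : ℝ) + 1)
        = 2 * X * ∑ j ∈ Finset.range ⌊X⌋₊, 1 / ((j : ℝ) + 1) := by
          rw [mul_assoc]
          simp only [Finset.mul_sum, mul_one_div]
      _ ≤ _ := by gcongr; linarith

/-- The large sieve bound: the weight `1 - t/(2T)` majorizes the interval `[0, T]` up to a factor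
`2`, and its Fourier transform decays quadratically, so no logarithm is lost. -/
theorem integral_polySq_le {T : ℝ} (hT : 0 < T) {s : Finset ℕ}
    (hs : ∀ n ∈ s, 1 ≤ n ∧ (n : ℝ) ≤ T) (c : ℕ → ℝ) :
    ∫ t in (0 : ℝ)..T, polySq s c t ≤ 10 * T * ∑ n ∈ s, c n ^ 2 := by
  have hcw : Continuous fun t : ℝ => 1 - t / (2 * T) := by fun_prop
  have hc := continuous_polySq s c
  have hle : ∫ t in (0 : ℝ)..T, polySq s c t ≤
      2 * ∫ t in (0 : ℝ)..(2 * T), (1 - t / (2 * T)) * polySq s c t := by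
    have hint : ∀ a b : ℝ, IntervalIntegrable (fun t => 2 * ((1 - t / (2 * T)) * polySq s c t))
        MeasureTheory.volume a b := fun a b => Continuous.intervalIntegrable (by fun_prop) _ _
    rw [← intervalIntegral.integral_const_mul]
    calc ∫ t in (0 : ℝ)..T, polySq s c t
        ≤ ∫ t in (0 : ℝ)..T, 2 * ((1 - t / (2 * T)) * polySq s c t) := by
          refine intervalIntegral.integral_mono_on hT.le (hc.intervalIntegrable _ _)
            (hint _ _) fun t ht => ?_
          have h1 : t / (2 * T) ≤ 1 / 2 := by
            rw [div_le_div_iff₀ (by positivity) two_pos]; linarith [ht.2]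
          nlinarith [polySq_nonneg s c t]
      _ ≤ _ := by
          rw [← intervalIntegral.integral_add_adjacent_intervals (hint 0 T) (hint T (2 * T))]
          refine le_add_of_nonneg_right (intervalIntegral.integral_nonneg (by linarith) ?_)
          intro t ht
          have h1 : t / (2 * T) ≤ 1 := by rw [div_le_one (by positivity)]; exact ht.2
          have := polySq_nonneg s c t
          have : 0 ≤ 1 - t / (2 * T) := by linarith
          positivity
  have hquad := abs_quadraticForm_sub_diag_le s c
    (fun m n => ∫ t in (0 : ℝ)..(2 * T), (1 - t / (2 * T)) *
      Real.cos ((Real.log m - Real.log n) * t))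
    (fun m n => T / |(m : ℝ) - n| ^ 2) (D := T) (B := 4 * T) ?_ ?_
    (fun m n => by rw [abs_sub_comm]) ?_
  · rw [← integral_mul_polySq hcw] at hquad
    have := (abs_le.mp hquad).2
    linarith
  · intro m _
    simp only [sub_self, zero_mul, Real.cos_zero, mul_one]
    rw [intervalIntegral.integral_sub (by simp) (Continuous.intervalIntegrable (by fun_prop) _ _),
      intervalIntegral.integral_div, integral_id]
    simp
    field_simp
    ring
  · intro m hm n hn hmn
    have hsp := abs_sub_div_le_abs_log_sub (hs m hm).1 (hs n hn).1 (hs m hm).2 (hs n hn).2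
    have hmn' : 0 < |(m : ℝ) - n| := abs_pos.mpr (sub_ne_zero.mpr (by exact_mod_cast hmn))
    have hpos : 0 < |Real.log m - Real.log n| := lt_of_lt_of_le (by positivity) hsp
    rw [integral_triangle_mul_cos (abs_pos.mp hpos) (by positivity), abs_div,
      abs_of_nonneg (sub_nonneg.mpr (Real.cos_le_one _)),
      abs_of_pos (mul_pos (by positivity) (sq_abs (Real.log m - Real.log n) ▸ by positivity)),
      ← sq_abs (Real.log m - Real.log n)]
    calc _ ≤ 2 / (2 * T * (|(m : ℝ) - n| / T) ^ 2) := by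
          gcongr; linarith [Real.neg_one_le_cos ((Real.log m - Real.log n) * (2 * T))]
      _ = _ := by field_simp
  · intro m hm
    have h1 := sum_erase_abs_sub_le (w := fun x => T / x ^ 2) (fun x hx => by positivity)
      (N := ⌊T⌋₊) (fun n hn => Nat.le_floor (hs n hn).2) hm
    refine h1.trans ?_
    have h2 := sum_range_inv_sq_le ⌊T⌋₊
    have h3 : (0 : ℝ) ≤ 1 / (⌊T⌋₊ : ℝ) := by positivity
    calc 2 * ∑ j ∈ Finset.range ⌊T⌋₊, T / ((j : ℝ) + 1) ^ 2
        = 2 * T * ∑ j ∈ Finset.range ⌊T⌋₊, 1 / ((j : ℝ) + 1) ^ 2 := by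
          rw [mul_assoc]
          simp only [Finset.mul_sum, mul_one_div]
      _ ≤ 2 * T * 2 := by gcongr; linarith
      _ = _ := by ring

/-- A weighted Cauchy inequality. -/
theorem abs_add_sq_sub_sq_le (a b : ℝ) {u : ℝ} (hu : 0 < u) :
    |(a + b) ^ 2 - a ^ 2| ≤ u * a ^ 2 + (1 + u⁻¹) * b ^ 2 := by
  have h : |2 * a * b| ≤ u * a ^ 2 + u⁻¹ * b ^ 2 := by
    have e : u * a ^ 2 + u⁻¹ * b ^ 2 - 2 * a * b = u * (a - u⁻¹ * b) ^ 2 := by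
      field_simp; ring
    have e' : u * a ^ 2 + u⁻¹ * b ^ 2 + 2 * a * b = u * (a + u⁻¹ * b) ^ 2 := by
      field_simp; ring
    have h1 : 0 ≤ u * (a - u⁻¹ * b) ^ 2 := by positivity
    have h2 : 0 ≤ u * (a + u⁻¹ * b) ^ 2 := by positivity
    rw [abs_le]
    constructor <;> linarith
  rw [abs_le] at h ⊢
  constructor <;> nlinarith [sq_nonneg b]

theorem abs_integral_polySq_union_sub_le {s₁ s₂ : Finset ℕ} (hd : Disjoint s₁ s₂) (c : ℕ → ℝ)
    {u T : ℝ} (hu : 0 < u) (hT : 0 ≤ T) :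
    |(∫ t in (0 : ℝ)..T, polySq (s₁ ∪ s₂) c t) - ∫ t in (0 : ℝ)..T, polySq s₁ c t| ≤
      u * (∫ t in (0 : ℝ)..T, polySq s₁ c t) +
        (1 + u⁻¹) * ∫ t in (0 : ℝ)..T, polySq s₂ c t := by
  have hi : ∀ s, IntervalIntegrable (polySq s c) MeasureTheory.volume 0 T :=
    fun s => (continuous_polySq s c).intervalIntegrable _ _
  have hpt : ∀ t, |polySq (s₁ ∪ s₂) c t - polySq s₁ c t| ≤
      u * polySq s₁ c t + (1 + u⁻¹) * polySq s₂ c t := by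
    intro t
    simp only [polySq, Finset.sum_union hd]
    have h1 := abs_le.mp (abs_add_sq_sub_sq_le (∑ n ∈ s₁, c n * Real.cos (t * Real.log n))
      (∑ n ∈ s₂, c n * Real.cos (t * Real.log n)) hu)
    have h2 := abs_le.mp (abs_add_sq_sub_sq_le (∑ n ∈ s₁, c n * Real.sin (t * Real.log n))
      (∑ n ∈ s₂, c n * Real.sin (t * Real.log n)) hu)
    rw [abs_le]
    constructor <;> linarith [h1.1, h1.2, h2.1, h2.2]
  rw [← intervalIntegral.integral_sub (hi _) (hi _), ← intervalIntegral.integral_const_mul,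
    ← intervalIntegral.integral_const_mul,
    ← intervalIntegral.integral_add ((hi _).const_mul _) ((hi _).const_mul _)]
  refine (intervalIntegral.abs_integral_le_integral_abs hT).trans ?_
  exact intervalIntegral.integral_mono_on hT ((hi _).sub (hi _)).abs
    (((hi _).const_mul _).add ((hi _).const_mul _)) fun t _ => hpt t

/-! ### The mean square of the divisor polynomial -/

/-- The coefficients `d_k(n) / √n`. -/
noncomputable def divisorCoeff (k n : ℕ) : ℝ := (divisorK k n : ℝ) / √(n : ℝ)

theorem norm_divisorPoly_sq (k : ℕ) (T t : ℝ) :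
    ‖divisorPoly k T t‖ ^ 2 = polySq (Finset.Ico 1 ⌈T⌉₊) (divisorCoeff k) t := by
  have h : divisorPoly k T t =
      ((∑ n ∈ Finset.Ico 1 ⌈T⌉₊, divisorCoeff k n * Real.cos (t * Real.log n) : ℝ) : ℂ) +
      ((-∑ n ∈ Finset.Ico 1 ⌈T⌉₊, divisorCoeff k n * Real.sin (t * Real.log n) : ℝ) : ℂ) *
        Complex.I := by
    rw [divisorPoly]
    push_cast
    rw [neg_mul, Finset.sum_mul, ← sub_eq_add_neg, ← Finset.sum_sub_distrib]
    refine Finset.sum_congr rfl fun n hn => ?_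
    have hn0 : 0 < n := (Finset.mem_Ico.mp hn).1
    have hnC : (n : ℂ) ≠ 0 := by exact_mod_cast hn0.ne'
    have hsq : (n : ℂ) ^ (1 / 2 : ℂ) = ((√(n : ℝ) : ℝ) : ℂ) := by
      rw [Real.sqrt_eq_rpow, Complex.ofReal_cpow (Nat.cast_nonneg n)]
      push_cast
      rfl
    have hexp : ((n : ℂ) ^ ((t : ℂ) * Complex.I))⁻¹ =
        Complex.cos (t * Real.log n) - Complex.sin (t * Real.log n) * Complex.I := by
      rw [Complex.cpow_def_of_ne_zero hnC, ← Complex.exp_neg, ← Complex.natCast_log]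
      rw [show -((Real.log n : ℂ) * (t * Complex.I)) = (-(t * Real.log n : ℂ)) * Complex.I by ring,
        Complex.exp_mul_I, Complex.cos_neg, Complex.sin_neg]
      ring
    rw [Complex.cpow_add _ _ hnC, hsq, div_eq_mul_inv, mul_inv, hexp, divisorCoeff]
    push_cast
    ring
  rw [h, ← Complex.normSq_eq_norm_sq, Complex.normSq_add_mul_I, polySq, neg_sq]

theorem sum_divisorCoeff_sq (k : ℕ) (x : ℝ) :
    ∑ n ∈ Finset.Ioc 0 ⌊x⌋₊, divisorCoeff k n ^ 2 =
      logSum (divisorSq k : ArithmeticFunction ℝ) x := by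
  refine Finset.sum_congr rfl fun n _ => ?_
  rw [divisorCoeff, div_pow, Real.sq_sqrt (Nat.cast_nonneg n), divisorSq_cast_apply]

/-- The length `T / log² T` of the short part of the Dirichlet polynomial: of the two logarithms,
one absorbs the loss in the trivial off-diagonal bound and the other makes the result `o(T)`. -/
noncomputable def shortLength (T : ℝ) : ℝ := T / Real.log T ^ 2

theorem tendsto_shortLength : Tendsto shortLength atTop atTop := by
  have h : Tendsto (fun T : ℝ => Real.log T ^ 2 / T) atTop (𝓝 0) :=
    (Real.isLittleO_pow_log_id_atTop (n := 2)).tendsto_div_nhds_zero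
  have h' : Tendsto (fun T : ℝ => Real.log T ^ 2 / T) atTop (𝓝[>] 0) := by
    refine tendsto_nhdsWithin_iff.mpr ⟨h, ?_⟩
    filter_upwards [eventually_gt_atTop 1] with T hT
    have := Real.log_pos hT
    exact Set.mem_Ioi.mpr (by positivity)
  refine h'.inv_tendsto_nhdsGT_zero.congr fun T => ?_
  simp [shortLength]

theorem tendsto_log_shortLength_div_log :
    Tendsto (fun T : ℝ => Real.log (shortLength T) / Real.log T) atTop (𝓝 1) := by
  have h : Tendsto (fun T : ℝ => Real.log (Real.log T) / Real.log T) atTop (𝓝 0) :=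
    Real.isLittleO_log_id_atTop.tendsto_div_nhds_zero.comp Real.tendsto_log_atTop
  have h' := (h.const_mul 2).const_sub 1
  rw [mul_zero, sub_zero] at h'
  refine h'.congr' ?_
  filter_upwards [eventually_gt_atTop 1] with T hT
  have hl := Real.log_pos hT
  rw [shortLength, Real.log_div (by positivity) (by positivity), Real.log_pow]
  field_simp
  push_cast
  ring

theorem tendsto_logSum_shortLength (k : ℕ) :
    Tendsto (fun T : ℝ => logSum (divisorSq k : ArithmeticFunction ℝ) (shortLength T) /
      Real.log T ^ (k ^ 2)) atTop (𝓝 (arithFactor k / ((k ^ 2)! : ℝ))) := by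
  have h := ((tendsto_logSum_divisorSq_div k).comp tendsto_shortLength).mul
    (tendsto_log_shortLength_div_log.pow (k ^ 2))
  rw [one_pow, mul_one] at h
  refine h.congr' ?_
  filter_upwards [tendsto_shortLength.eventually_gt_atTop 1] with T hT
  have hl := Real.log_pos hT
  rw [Function.comp_apply, div_pow, div_mul_div_cancel₀ (by positivity)]

theorem logSum_divisorSq_nonneg (k : ℕ) (x : ℝ) :
    0 ≤ logSum (divisorSq k : ArithmeticFunction ℝ) x := by
  rw [← sum_divisorCoeff_sq]; positivity

/-- The mean square of the part `n ≤ T / log² T`, which carries the main term. -/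
theorem tendsto_integral_short (k : ℕ) :
    Tendsto (fun T : ℝ => (∫ t in (0 : ℝ)..T,
      polySq (Finset.Ioc 0 ⌊shortLength T⌋₊) (divisorCoeff k) t) / (T * Real.log T ^ (k ^ 2)))
      atTop (𝓝 (arithFactor k / ((k ^ 2)! : ℝ))) := by
  have hS := tendsto_logSum_shortLength k
  have herr : Tendsto (fun T : ℝ => 2 * ((1 + Real.log T) / Real.log T ^ 2) *
      (logSum (divisorSq k : ArithmeticFunction ℝ) (shortLength T) / Real.log T ^ (k ^ 2)))
      atTop (𝓝 0) := by
    have h1 : Tendsto (fun y : ℝ => 2 * ((1 + y) / y ^ 2)) atTop (𝓝 0) := by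
      have h2 := ((tendsto_inv_atTop_zero (𝕜 := ℝ)).pow 2).add (tendsto_inv_atTop_zero (𝕜 := ℝ))
      have h3 := h2.const_mul 2
      norm_num at h3
      refine h3.congr' ?_
      filter_upwards [eventually_gt_atTop 0] with y hy
      field_simp
    have := (h1.comp Real.tendsto_log_atTop).mul hS
    rwa [zero_mul] at this
  have hdiff : Tendsto (fun T : ℝ => (∫ t in (0 : ℝ)..T,
      polySq (Finset.Ioc 0 ⌊shortLength T⌋₊) (divisorCoeff k) t) / (T * Real.log T ^ (k ^ 2)) -
      logSum (divisorSq k : ArithmeticFunction ℝ) (shortLength T) / Real.log T ^ (k ^ 2))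
      atTop (𝓝 0) := by
    refine squeeze_zero_norm' ?_ herr
    filter_upwards [eventually_gt_atTop (Real.exp 1), tendsto_shortLength.eventually_ge_atTop 1]
      with T hT hY
    have hT0 : 0 < T := (Real.exp_pos 1).trans hT
    have hl : 1 < Real.log T := by
      rw [← Real.log_exp 1]; exact Real.log_lt_log (Real.exp_pos 1) hT
    have hYT : shortLength T ≤ T := div_le_self hT0.le (one_le_pow₀ hl.le)
    have hmv := abs_integral_polySq_sub_le (T := T) hY (s := Finset.Ioc 0 ⌊shortLength T⌋₊)
      (fun n hn => ⟨(Finset.mem_Ioc.mp hn).1,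
        (Nat.le_floor_iff (by linarith)).mp (Finset.mem_Ioc.mp hn).2⟩) (divisorCoeff k)
    rw [sum_divisorCoeff_sq] at hmv
    have hS0 := logSum_divisorSq_nonneg k (shortLength T)
    set S := logSum (divisorSq k : ArithmeticFunction ℝ) (shortLength T)
    set I := ∫ t in (0 : ℝ)..T, polySq (Finset.Ioc 0 ⌊shortLength T⌋₊) (divisorCoeff k) t
    have e : I / (T * Real.log T ^ (k ^ 2)) - S / Real.log T ^ (k ^ 2) =
        (I - T * S) / (T * Real.log T ^ (k ^ 2)) := by
      field_simp
    rw [e, Real.norm_eq_abs, abs_div, abs_of_pos (show 0 < T * Real.log T ^ (k ^ 2) by positivity),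
      div_le_iff₀ (by positivity)]
    calc |I - T * S| ≤ 2 * shortLength T * (1 + Real.log (shortLength T)) * S := hmv
      _ ≤ 2 * shortLength T * (1 + Real.log T) * S := by
          have := Real.log_le_log (by linarith) hYT
          gcongr
      _ = _ := by
          rw [shortLength]
          field_simp
  have := hdiff.add hS
  simpa using this

/-- The mean square of the part `T / log² T < n < T` is of smaller order. -/
theorem tendsto_integral_long (k : ℕ) :
    Tendsto (fun T : ℝ => (∫ t in (0 : ℝ)..T,
      polySq (Finset.Ico 1 ⌈T⌉₊ \ Finset.Ioc 0 ⌊shortLength T⌋₊) (divisorCoeff k) t) /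
        (T * Real.log T ^ (k ^ 2))) atTop (𝓝 0) := by
  have h := ((tendsto_logSum_divisorSq_div k).sub (tendsto_logSum_shortLength k)).const_mul 10
  rw [sub_self, mul_zero] at h
  refine squeeze_zero' ?_ ?_ h
  · filter_upwards [eventually_ge_atTop 1] with T hT
    have := Real.log_nonneg hT
    exact div_nonneg (intervalIntegral.integral_nonneg (by linarith) fun t _ => polySq_nonneg _ _ _)
      (by positivity)
  · filter_upwards [eventually_gt_atTop (Real.exp 1)] with T hT
    have hT0 : 0 < T := (Real.exp_pos 1).trans hT
    have hl : 1 < Real.log T := by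
      rw [← Real.log_exp 1]; exact Real.log_lt_log (Real.exp_pos 1) hT
    have hYT : shortLength T ≤ T := div_le_self hT0.le (one_le_pow₀ hl.le)
    have hlt : ∀ n ∈ Finset.Ico 1 ⌈T⌉₊, 1 ≤ n ∧ (n : ℝ) ≤ T := fun n hn =>
      ⟨(Finset.mem_Ico.mp hn).1, (Nat.lt_ceil.mp (Finset.mem_Ico.mp hn).2).le⟩
    have hI := integral_polySq_le hT0 (s := Finset.Ico 1 ⌈T⌉₊ \ Finset.Ioc 0 ⌊shortLength T⌋₊)
      (fun n hn => hlt n (Finset.mem_sdiff.mp hn).1) (divisorCoeff k)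
    have hsum : ∑ n ∈ Finset.Ico 1 ⌈T⌉₊ \ Finset.Ioc 0 ⌊shortLength T⌋₊, divisorCoeff k n ^ 2 ≤
        logSum (divisorSq k : ArithmeticFunction ℝ) T -
          logSum (divisorSq k : ArithmeticFunction ℝ) (shortLength T) := by
      rw [← sum_divisorCoeff_sq, ← sum_divisorCoeff_sq, ← Finset.sum_sdiff_eq_sub
        (Finset.Ioc_subset_Ioc_right (Nat.floor_mono hYT))]
      refine Finset.sum_le_sum_of_subset_of_nonneg (Finset.sdiff_subset_sdiff ?_ le_rfl)
        fun _ _ _ => sq_nonneg _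
      intro n hn
      exact Finset.mem_Ioc.mpr ⟨(hlt n hn).1, Nat.le_floor (hlt n hn).2⟩
    rw [div_le_iff₀ (by positivity)]
    refine (hI.trans (mul_le_mul_of_nonneg_left hsum (by positivity))).trans (le_of_eq ?_)
    field_simp

/-- The two parts are combined with the weighted Cauchy inequality, so that the cross term is
negligible as well. -/
theorem tendsto_integral_divisorPoly_div (k : ℕ) :
    Tendsto (fun T : ℝ => (∫ t in (0 : ℝ)..T, ‖divisorPoly k T t‖ ^ 2) /
      (T * Real.log T ^ (k ^ 2))) atTop (𝓝 (arithFactor k / ((k ^ 2)! : ℝ))) := by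
  have h1 := tendsto_integral_short k
  have h2 := tendsto_integral_long k
  set ρ : ℝ → ℝ := fun T => (∫ t in (0 : ℝ)..T,
      polySq (Finset.Ico 1 ⌈T⌉₊ \ Finset.Ioc 0 ⌊shortLength T⌋₊) (divisorCoeff k) t) /
        (T * Real.log T ^ (k ^ 2)) with hρ
  set J : ℝ → ℝ := fun T => (∫ t in (0 : ℝ)..T,
      polySq (Finset.Ioc 0 ⌊shortLength T⌋₊) (divisorCoeff k) t) /
        (T * Real.log T ^ (k ^ 2)) with hJ
  -- the parameter of the weighted Cauchy inequality; the summand `1/T` only makes it positive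
  have hu : Tendsto (fun T : ℝ => √(ρ T) + 1 / T) atTop (𝓝 0) := by
    have := h2.sqrt.add (tendsto_const_nhds.div_atTop tendsto_id (a := (1 : ℝ)))
    simpa using this
  have hbound : Tendsto (fun T : ℝ => (√(ρ T) + 1 / T) * J T + (ρ T + (√(ρ T) + 1 / T))) atTop
      (𝓝 0) := by
    have := (hu.mul h1).add (h2.add hu)
    simpa using this
  have hdiff : Tendsto (fun T : ℝ => (∫ t in (0 : ℝ)..T, ‖divisorPoly k T t‖ ^ 2) /
      (T * Real.log T ^ (k ^ 2)) - J T) atTop (𝓝 0) := by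
    refine squeeze_zero_norm' ?_ hbound
    filter_upwards [eventually_gt_atTop (Real.exp 1)] with T hT
    have hT0 : 0 < T := (Real.exp_pos 1).trans hT
    have hl : 1 < Real.log T := by
      rw [← Real.log_exp 1]; exact Real.log_lt_log (Real.exp_pos 1) hT
    have hYT : shortLength T < T := div_lt_self hT0 (one_lt_pow₀ hl two_ne_zero)
    have hsub : Finset.Ioc 0 ⌊shortLength T⌋₊ ⊆ Finset.Ico 1 ⌈T⌉₊ := by
      intro n hn
      obtain ⟨hn0, hn1⟩ := Finset.mem_Ioc.mp hn
      have hY0 : 0 ≤ shortLength T := by unfold shortLength; positivity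
      exact Finset.mem_Ico.mpr ⟨hn0, Nat.lt_ceil.mpr (((Nat.le_floor_iff hY0).mp hn1).trans_lt hYT)⟩
    have hW : 0 < T * Real.log T ^ (k ^ 2) := by positivity
    have hρ0 : 0 ≤ ρ T := div_nonneg
      (intervalIntegral.integral_nonneg hT0.le fun t _ => polySq_nonneg _ _ _) hW.le
    have hu0 : 0 < √(ρ T) + 1 / T := by positivity
    have hkey := abs_integral_polySq_union_sub_le (s₁ := Finset.Ioc 0 ⌊shortLength T⌋₊)
      (s₂ := Finset.Ico 1 ⌈T⌉₊ \ Finset.Ioc 0 ⌊shortLength T⌋₊) Finset.disjoint_sdiff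
      (divisorCoeff k) hu0 hT0.le
    rw [Finset.union_sdiff_of_subset hsub] at hkey
    simp only [norm_divisorPoly_sq]
    have hρu : (√(ρ T) + 1 / T)⁻¹ * ρ T ≤ √(ρ T) + 1 / T := by
      rw [inv_mul_le_iff₀ hu0]
      have : √(ρ T) ≤ √(ρ T) + 1 / T := le_add_of_nonneg_right (by positivity)
      calc ρ T = √(ρ T) * √(ρ T) := (Real.mul_self_sqrt hρ0).symm
        _ ≤ _ := by gcongr
    rw [hJ]
    dsimp only
    rw [← sub_div, Real.norm_eq_abs, abs_div, abs_of_pos hW]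
    refine (div_le_div_of_nonneg_right hkey hW.le).trans ?_
    rw [add_div, mul_div_assoc, mul_div_assoc]
    change (√(ρ T) + 1 / T) * J T + (1 + (√(ρ T) + 1 / T)⁻¹) * ρ T ≤ _
    rw [add_mul 1, one_mul]
    gcongr
  have := hdiff.add h1
  simpa using this

/-- Asymptotic equivalence follows from the limit of the quotient because `a_k ≠ 0`. -/
theorem isEquivalent_integral_divisorPoly (k : ℕ) :
    (fun T : ℝ => ∫ t in (0 : ℝ)..T, ‖divisorPoly k T t‖ ^ 2) ~[atTop]
      (fun T : ℝ => arithFactor k / ((k ^ 2)! : ℝ) * T * Real.log T ^ (k ^ 2)) := by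
  have hA : arithFactor k / ((k ^ 2)! : ℝ) ≠ 0 :=
    div_ne_zero (arithFactor_ne_zero k) (by positivity)
  refine isEquivalent_of_tendsto_one ?_
  have h := (tendsto_integral_divisorPoly_div k).div_const (arithFactor k / ((k ^ 2)! : ℝ))
  rw [div_self hA] at h
  refine h.congr fun T => ?_
  rw [Pi.div_apply, div_div, mul_comm (T * _), mul_assoc]

end

theorem mainTheorem2 (k : ℕ) :
    -- the mean square of the Dirichlet polynomial of length `T`
    ((fun T : ℝ => ∫ t in (0 : ℝ)..T, ‖divisorPoly k T t‖ ^ 2) ~[atTop]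
      (fun T : ℝ => arithFactor k / ((k ^ 2)! : ℝ) * T * Real.log T ^ (k ^ 2))) ∧
    -- the series and the product that define `a_k` converge
    (∀ p : ℕ, p.Prime → Summable (localTerm k p)) ∧
    Multipliable (fun p : Nat.Primes => localFactor k p) ∧
    -- the binomial coefficients in `a_k` are the values of `d_k` at prime powers
    (∀ p m : ℕ, p.Prime → divisorK k (p ^ m) = (k + m - 1).choose m) ∧
    -- `a_k` is the leading coefficient of `F` at `s = 1`
    (∀ s : ℂ, 1 < s.re → LSeriesSummable (fun n => (divisorK k n : ℂ) ^ 2) s) ∧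
    Tendsto (fun s : ℂ => (s - 1) ^ (k ^ 2) * divisorSqSeries k s)
      (𝓝[{s : ℂ | 1 < s.re}] 1) (𝓝 (arithFactor k : ℂ)) ∧
    Tendsto (fun s : ℂ => (riemannZeta s ^ (k ^ 2))⁻¹ * divisorSqSeries k s)
      (𝓝[{s : ℂ | 1 < s.re}] 1) (𝓝 (arithFactor k : ℂ)) := by
  exact ⟨isEquivalent_integral_divisorPoly k, fun p hp => summable_localTerm k hp,
    (hasProd_localFactor k).multipliable, fun p m hp => divisorK_prime_pow k hp m,
    fun s hs => (divisorSqSeries_eq k hs).1, tendsto_sub_one_pow_mul_divisorSqSeries k,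
    tendsto_inv_zeta_mul_divisorSqSeries k⟩
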